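/- Consider pure states of three qubits, i.e. nonzero vectors of $\mathbb C^2\otimes\mathbb C^2\otimes\mathbb C^2$, where normalization and global phase are ignored. Two states are LU equivalent if $|\psi\rangle = c\,U_1\otimes U_2\otimes U_3|\phi\rangle$ with unitary $U_i$ and $c\neq 0$. A state is fully entangled if it does not factorize across any of the three bipartitions of the parties. "$|\phi\rangle$ is obtained from $|\psi\rangle$ by LOCC" means that a protocol of finitely many rounds of local generalized measurements (with finitely many outcomes, local ancillas allowed), each chosen depending on the previously announced outcomes, yields $|\phi\rangle$ up to a scalar in every branch of nonzero probability. A maximally entangled set of three qubits is a set $S$ of fully entangled states, closed under LU equivalence, such that (i) if a state in $S$ is obtained by LOCC from some three-qubit state $|\psi\rangle$, then $|\psi\rangle$ is LU equivalent to it, and (ii) every fully entangled state not in $S$ is obtained by LOCC from some state in $S$. **Theorem 1.** There is exactly one maximally entangled set $MES_3$ of three qubits. It consists of all states that are LU equivalent to one of the following: - $|GHZ\rangle=|000\rangle+|111\rangle$; - $g_x^1\otimes g_x^2\otimes g_x^3|GHZ\rangle$, where each $g_x^i$ is a positive definite element of $\mathrm{span}\{\mathbb 1,X\}$ and no $g_x^i$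 is proportional to $\mathbb 1$; - $g_1\otimes g_2\otimes\mathbb 1|W\rangle$, where $|W\rangle=|001\rangle+|010\rangle+|100\rangle$ and $g_1,g_2$ are diagonal and invertible. Moreover, $MES_3$ is the least (with respect to inclusion) LU-closed set of fully entangled three-qubit states that has property (ii). -/

import Mathlib

open scoped Kronecker Matrix ComplexOrder

noncomputable section

namespace MES

/-- (Unnormalised) state vectors of three parties with local dimensions `a`, `b`, `c`, given by
their amplitudes in the computational basis, that is, elements of `ℂ^a ⊗ ℂ^b ⊗ ℂ^c`. -/
abbrev State (a b c : ℕ) : Type := Fin a × Fin b × Fin c → ℂ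

/-- The product operator `A ⊗ B ⊗ C` applied to a state vector. -/
def localOp {a b c a' b' c' : ℕ} (A : Matrix (Fin a') (Fin a) ℂ) (B : Matrix (Fin b') (Fin b) ℂ)
    (C : Matrix (Fin c') (Fin c) ℂ) (ψ : State a b c) : State a' b' c' :=
  (A ⊗ₖ (B ⊗ₖ C)) *ᵥ ψ

/-- The computational basis vector `|i j k⟩` of three qubits. -/
def ket (i j k : Fin 2) : State 2 2 2 := Pi.single (i, j, k) 1

/-- `|GHZ⟩ = |000⟩ + |111⟩`. -/
def ghz : State 2 2 2 := ket 0 0 0 + ket 1 1 1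

/-- `|W⟩ = |001⟩ + |010⟩ + |100⟩`. -/
def wState : State 2 2 2 := ket 0 0 1 + ket 0 1 0 + ket 1 0 0

/-- The Pauli matrix `X`. -/
def pauliX : Matrix (Fin 2) (Fin 2) ℂ := !![0, 1; 1, 0]

/-- Fully (truly tripartite) entangled three-qubit states: the vector does not factorise across any
of the three bipartitions of the parties. In particular it is nonzero. -/
def FullyEntangled (ψ : State 2 2 2) : Prop :=
  (¬ ∃ (f : Fin 2 → ℂ) (g : Fin 2 → Fin 2 → ℂ), ∀ i j k, ψ (i, j, k) = f i * g j k) ∧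
  (¬ ∃ (f : Fin 2 → ℂ) (g : Fin 2 → Fin 2 → ℂ), ∀ i j k, ψ (i, j, k) = f j * g i k) ∧
  (¬ ∃ (f : Fin 2 → ℂ) (g : Fin 2 → Fin 2 → ℂ), ∀ i j k, ψ (i, j, k) = f k * g i j)

/-- Local unitary equivalence; normalisation and global phase are ignored. -/
def LUEquiv (ψ φ : State 2 2 2) : Prop :=
  ∃ U₁ ∈ Matrix.unitaryGroup (Fin 2) ℂ, ∃ U₂ ∈ Matrix.unitaryGroup (Fin 2) ℂ,
    ∃ U₃ ∈ Matrix.unitaryGroup (Fin 2) ℂ, ∃ c : ℂ, c ≠ 0 ∧ ψ = c • localOp U₁ U₂ U₃ φ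

/-- Finite LOCC protocols that start with local dimensions `a`, `b`, `c` and end with three qubits.
In every round one party performs a generalised measurement on its system, with Kraus operators
`K r` satisfying `∑ r, (K r)ᴴ * K r = 1`, and announces the outcome `r`; the rest of the protocol
may depend on `r`. A Kraus operator may change the dimension of the measuring party's system, so
that local ancillas can be appended, kept over several rounds and removed; a one-outcome
measurement is a local isometry, for instance a local unitary. -/
inductive Protocol : ℕ → ℕ → ℕ → Type
  | finish : Protocol 2 2 2
  | party1 {a b c m : ℕ} (a' : Fin m → ℕ) (K : (r : Fin m) → Matrix (Fin (a' r)) (Fin a) ℂ)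
      (hK : ∑ r, (K r)ᴴ * K r = 1) (next : (r : Fin m) → Protocol (a' r) b c) : Protocol a b c
  | party2 {a b c m : ℕ} (b' : Fin m → ℕ) (K : (r : Fin m) → Matrix (Fin (b' r)) (Fin b) ℂ)
      (hK : ∑ r, (K r)ᴴ * K r = 1) (next : (r : Fin m) → Protocol a (b' r) c) : Protocol a b c
  | party3 {a b c m : ℕ} (c' : Fin m → ℕ) (K : (r : Fin m) → Matrix (Fin (c' r)) (Fin c) ℂ)
      (hK : ∑ r, (K r)ᴴ * K r = 1) (next : (r : Fin m) → Protocol a b (c' r)) : Protocol a b c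

/-- The protocol, run on `ψ`, produces `φ` deterministically: in every branch the final
(unnormalised) vector is a multiple of `φ`, where the multiple zero belongs to a branch that occurs
with probability zero. -/
def Protocol.Produces (φ : State 2 2 2) : {a b c : ℕ} → Protocol a b c → State a b c → Prop
  | _, _, _, .finish, ψ => ∃ z : ℂ, ψ = z • φ
  | _, _, _, .party1 _ K _ next, ψ => ∀ r, (next r).Produces φ (localOp (K r) 1 1 ψ)
  | _, _, _, .party2 _ K _ next, ψ => ∀ r, (next r).Produces φ (localOp 1 (K r) 1 ψ)
  | _, _, _, .party3 _ K _ next, ψ => ∀ r, (next r).Produces φ (localOp 1 1 (K r) ψ)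

/-- `φ` can be obtained from `ψ` deterministically by LOCC. -/
def LOCCReaches (ψ φ : State 2 2 2) : Prop :=
  ∃ P : Protocol 2 2 2, P.Produces φ ψ

/-- A set of LU classes of fully entangled three-qubit states (given as the set of all vectors in
these classes) from which every other fully entangled three-qubit state can be obtained by LOCC. -/
structure IsCovering (S : Set (State 2 2 2)) : Prop where
  entangled : ∀ φ ∈ S, FullyEntangled φ
  lu_closed : ∀ φ ∈ S, ∀ ψ, LUEquiv ψ φ → ψ ∈ S
  covers : ∀ φ, FullyEntangled φ → φ ∉ S → ∃ ψ ∈ S, LOCCReaches ψ φ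

/-- `S` is a maximally entangled set of three qubits: every other fully entangled state can be
obtained by LOCC from a state in `S`, and no state in `S` can be obtained by LOCC from any other
three-qubit state, where LU equivalent states are not regarded as different. -/
structure IsMaximallyEntangledSet (S : Set (State 2 2 2)) : Prop extends IsCovering S where
  unreachable : ∀ φ ∈ S, ∀ ψ : State 2 2 2, ψ ≠ 0 → LOCCReaches ψ φ → LUEquiv ψ φ

/-- The operators `g_x` not proportional to the identity: `g` lies in `span {1, X}`, it is the
positive square root of the positive definite operator `gᴴ * g` (a convention that removes a local
unitary factor), and it is not a multiple of the identity. -/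
def IsNontrivialGx (g : Matrix (Fin 2) (Fin 2) ℂ) : Prop :=
  g ∈ Submodule.span ℂ ({1, pauliX} : Set (Matrix (Fin 2) (Fin 2) ℂ)) ∧ g.PosDef ∧
    ¬ ∃ z : ℂ, g = z • (1 : Matrix (Fin 2) (Fin 2) ℂ)

/-- The representatives `|GHZ⟩`, `g_x¹ ⊗ g_x² ⊗ g_x³ |GHZ⟩` with no `g_xⁱ` proportional to the
identity, and `g₁ ⊗ g₂ ⊗ 1 |W⟩` with `g₁`, `g₂` diagonal and invertible. -/
def mes3Representatives : Set (State 2 2 2) :=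
  {ghz} ∪
  {φ | ∃ g₁ g₂ g₃ : Matrix (Fin 2) (Fin 2) ℂ, IsNontrivialGx g₁ ∧ IsNontrivialGx g₂ ∧
    IsNontrivialGx g₃ ∧ φ = localOp g₁ g₂ g₃ ghz} ∪
  {φ | ∃ g₁ g₂ : Matrix (Fin 2) (Fin 2) ℂ, g₁.IsDiag ∧ IsUnit g₁ ∧ g₂.IsDiag ∧ IsUnit g₂ ∧
    φ = localOp g₁ g₂ 1 wState}

/-- All states that are LU equivalent to one of the representatives. -/
def mes3 : Set (State 2 2 2) :=
  {ψ | ∃ φ ∈ mes3Representatives, LUEquiv ψ φ}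

end MES

end

/-! Unreachability rests on one property of a fully entangled state φ, `Rigid`. Write a node of a
protocol started from a local image of φ as A ⊗ B ⊗ C φ, and keep track of the Gram operators AᴴA,
BᴴB, CᴴC only: they stay 2 × 2 whatever ancillas are used, and the completeness relation says that
the Gram operator of the measuring party is the sum of those of the children, while the other two do
not change. At a leaf, A ⊗ B ⊗ C is a local stabiliser of φ, up to branches of probability zero. If
two children carry the Grams of stabilisers T and T', then T'T⁻¹ is a stabiliser that is unitary on
the two passive parties. Rigidity makes it proportional to a unitary on the third, so the children's
Grams are proportional and their sum is again the Gram of a stabiliser. Going backwards to the root,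
the initial state is Nφ with NᴴN = TᴴT for a stabiliser T; hence it is proportional to (NT⁻¹)φ with
NT⁻¹ a local unitary. This is `Rigid.luEquiv_of_loccReaches`.

Rigidity of the representatives follows from explicit stabilisers: for GHZ, triples of diagonal or
of antidiagonal matrices (`stabilizer_ghz`); for W-type states, triples of upper triangular
matrices.

For the covering property, every fully entangled state is a local image of GHZ or W
(`FullyEntangled.exists_eq_op`). Up to local unitaries it is either w|000⟩ + x₀|100⟩ + x₁|010⟩ +
x₂|001⟩ or g₁ ⊗ g₂ ⊗ g₃ (|000⟩ + z|111⟩) with gᵢ in the span of 1 and X. Two-outcome measurements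
whose outcomes differ by a Pauli correction remove w, respectively z, and lead back to a
representative.

Uniqueness and minimality are then formal: a state reachable only from its own LU class lies in
every covering set, and an unreachable state is LU equivalent to the representative that reaches it.
-/

namespace MES

/-! ### Local operators and their products -/

lemma localOp_apply {a b c a' b' c' : ℕ} (A : Matrix (Fin a') (Fin a) ℂ)
    (B : Matrix (Fin b') (Fin b) ℂ) (C : Matrix (Fin c') (Fin c) ℂ) (ψ : State a b c)
    (i : Fin a') (j : Fin b') (k : Fin c') :
    localOp A B C ψ (i, j, k) =
      ∑ i', ∑ j', ∑ k', A i i' * (B j j' * C k k') * ψ (i', j', k') := by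
  simp [localOp, Matrix.mulVec, dotProduct, Fintype.sum_prod_type, Matrix.kroneckerMap_apply]

lemma localOp_localOp {a b c a' b' c' a'' b'' c'' : ℕ} (A : Matrix (Fin a') (Fin a) ℂ)
    (B : Matrix (Fin b') (Fin b) ℂ) (C : Matrix (Fin c') (Fin c) ℂ)
    (A' : Matrix (Fin a'') (Fin a') ℂ)
    (B' : Matrix (Fin b'') (Fin b') ℂ) (C' : Matrix (Fin c'') (Fin c') ℂ) (ψ : State a b c) :
    localOp A' B' C' (localOp A B C ψ) = localOp (A' * A) (B' * B) (C' * C) ψ := by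
  simp only [localOp, Matrix.mulVec_mulVec, Matrix.mul_kronecker_mul]

lemma localOp_one {a b c : ℕ} (ψ : State a b c) : localOp 1 1 1 ψ = ψ := by
  simp [localOp]

lemma localOp_smul {a b c a' b' c' : ℕ} (A : Matrix (Fin a') (Fin a) ℂ)
    (B : Matrix (Fin b') (Fin b) ℂ) (C : Matrix (Fin c') (Fin c) ℂ) (z : ℂ) (ψ : State a b c) :
    localOp A B C (z • ψ) = z • localOp A B C ψ := by
  simp [localOp, Matrix.mulVec_smul]

lemma localOp_zero {a b c a' b' c' : ℕ} (A : Matrix (Fin a') (Fin a) ℂ)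
    (B : Matrix (Fin b') (Fin b) ℂ) (C : Matrix (Fin c') (Fin c) ℂ) :
    localOp A B C (0 : State a b c) = 0 := by
  simp [localOp]

lemma localOp_sum₁ {a b c a' b' c' m : ℕ} (A : Fin m → Matrix (Fin a') (Fin a) ℂ)
    (B : Matrix (Fin b') (Fin b) ℂ) (C : Matrix (Fin c') (Fin c) ℂ) (ψ : State a b c) :
    localOp (∑ r, A r) B C ψ = ∑ r, localOp (A r) B C ψ := by
  induction (Finset.univ : Finset (Fin m)) using Finset.induction_on with
  | empty => simp [localOp]
  | insert r s hr ih =>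
    rw [Finset.sum_insert hr, Finset.sum_insert hr, ← ih]
    simp [localOp, Matrix.add_kronecker, Matrix.add_mulVec]

lemma localOp_sum₂ {a b c a' b' c' m : ℕ} (A : Matrix (Fin a') (Fin a) ℂ)
    (B : Fin m → Matrix (Fin b') (Fin b) ℂ) (C : Matrix (Fin c') (Fin c) ℂ) (ψ : State a b c) :
    localOp A (∑ r, B r) C ψ = ∑ r, localOp A (B r) C ψ := by
  induction (Finset.univ : Finset (Fin m)) using Finset.induction_on with
  | empty => simp [localOp]
  | insert r s hr ih =>
    rw [Finset.sum_insert hr, Finset.sum_insert hr, ← ih]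
    simp [localOp, Matrix.add_kronecker, Matrix.kronecker_add, Matrix.add_mulVec]

lemma localOp_sum₃ {a b c a' b' c' m : ℕ} (A : Matrix (Fin a') (Fin a) ℂ)
    (B : Matrix (Fin b') (Fin b) ℂ) (C : Fin m → Matrix (Fin c') (Fin c) ℂ) (ψ : State a b c) :
    localOp A B (∑ r, C r) ψ = ∑ r, localOp A B (C r) ψ := by
  induction (Finset.univ : Finset (Fin m)) using Finset.induction_on with
  | empty => simp [localOp]
  | insert r s hr ih =>
    rw [Finset.sum_insert hr, Finset.sum_insert hr, ← ih]
    simp [localOp, Matrix.kronecker_add, Matrix.add_mulVec]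

/-- A triple of operators on the three qubits, representing their tensor product. -/
abbrev LocalTriple : Type := Fin 3 → Matrix (Fin 2) (Fin 2) ℂ

/-- The action of a triple of one-qubit operators on three-qubit states. -/
noncomputable def op (M : LocalTriple) (ψ : State 2 2 2) : State 2 2 2 :=
  localOp (M 0) (M 1) (M 2) ψ

lemma op_apply (M : LocalTriple) (ψ : State 2 2 2) (i j k : Fin 2) :
    op M ψ (i, j, k) = ∑ i', ∑ j', ∑ k', M 0 i i' * (M 1 j j' * M 2 k k') * ψ (i', j', k') :=
  localOp_apply _ _ _ _ _ _ _

lemma op_op (M N : LocalTriple) (ψ : State 2 2 2) : op M (op N ψ) = op (M * N) ψ := by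
  simp only [op, localOp_localOp, Pi.mul_apply]

lemma op_one (ψ : State 2 2 2) : op 1 ψ = ψ := localOp_one ψ

lemma op_smul (M : LocalTriple) (z : ℂ) (ψ : State 2 2 2) : op M (z • ψ) = z • op M ψ :=
  localOp_smul _ _ _ _ _

lemma op_zero (M : LocalTriple) : op M 0 = 0 := localOp_zero _ _ _

lemma op_smul_left (d : Fin 3 → ℂ) (M : LocalTriple) (ψ : State 2 2 2) :
    op (fun i => d i • M i) ψ = (d 0 * d 1 * d 2) • op M ψ := by
  simp only [op, localOp, Matrix.smul_kronecker, Matrix.kronecker_smul, Matrix.smul_mulVec,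
    smul_smul]
  congr 1
  ring

lemma op_update_sum {m : ℕ} (G : LocalTriple) (i : Fin 3)
    (X : Fin m → Matrix (Fin 2) (Fin 2) ℂ) (ψ : State 2 2 2) :
    op (Function.update G i (∑ r, X r)) ψ = ∑ r, op (Function.update G i (X r)) ψ := by
  fin_cases i <;> simp [op, localOp_sum₁, localOp_sum₂, localOp_sum₃]

lemma op_inv_op {M : LocalTriple} (hM : ∀ i, (M i).det ≠ 0) (ψ : State 2 2 2) :
    op (fun i => (M i)⁻¹) (op M ψ) = ψ := by
  have : (fun i => (M i)⁻¹) * M = 1 := by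
    ext1 i
    simp [Matrix.nonsing_inv_mul _ (hM i).isUnit]
  rw [op_op, this, op_one]

/-! ### Full entanglement under local operators -/

lemma FullyEntangled.of_op {M : LocalTriple} {ψ : State 2 2 2} (h : FullyEntangled (op M ψ)) :
    FullyEntangled ψ := by
  obtain ⟨h1, h2, h3⟩ := h
  refine ⟨fun ⟨f, g, hfg⟩ => h1 ⟨fun i => ∑ i', M 0 i i' * f i', fun j k =>
      ∑ j', ∑ k', M 1 j j' * M 2 k k' * g j' k', fun i j k => ?_⟩,
    fun ⟨f, g, hfg⟩ => h2 ⟨fun j => ∑ j', M 1 j j' * f j', fun i k =>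
      ∑ i', ∑ k', M 0 i i' * M 2 k k' * g i' k', fun i j k => ?_⟩,
    fun ⟨f, g, hfg⟩ => h3 ⟨fun k => ∑ k', M 2 k k' * f k', fun i j =>
      ∑ i', ∑ j', M 0 i i' * M 1 j j' * g i' j', fun i j k => ?_⟩⟩ <;>
  · simp only [op_apply, hfg, Fin.sum_univ_two]
    ring

lemma FullyEntangled.op {M : LocalTriple} {ψ : State 2 2 2} (h : FullyEntangled ψ)
    (hM : ∀ i, (M i).det ≠ 0) : FullyEntangled (op M ψ) := by
  rw [← op_inv_op hM ψ] at h
  exact h.of_op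

lemma FullyEntangled.ne_zero {ψ : State 2 2 2} (h : FullyEntangled ψ) : ψ ≠ 0 := by
  rintro rfl
  exact h.1 ⟨0, 0, by simp⟩

lemma FullyEntangled.of_smul {z : ℂ} {ψ : State 2 2 2} (h : FullyEntangled (z • ψ)) :
    FullyEntangled ψ := by
  obtain ⟨h1, h2, h3⟩ := h
  refine ⟨fun ⟨f, g, hfg⟩ => h1 ⟨z • f, g, fun i j k => ?_⟩,
    fun ⟨f, g, hfg⟩ => h2 ⟨z • f, g, fun i j k => ?_⟩,
    fun ⟨f, g, hfg⟩ => h3 ⟨z • f, g, fun i j k => ?_⟩⟩ <;>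
  simp [hfg, mul_assoc]

lemma FullyEntangled.smul {z : ℂ} (hz : z ≠ 0) {ψ : State 2 2 2} (h : FullyEntangled ψ) :
    FullyEntangled (z • ψ) := by
  refine FullyEntangled.of_smul (z := z⁻¹) ?_
  rwa [smul_smul, inv_mul_cancel₀ hz, one_smul]

lemma exists_rank_one_of_det_eq_zero {A : Matrix (Fin 2) (Fin 2) ℂ} (h : A.det = 0) :
    ∃ u w : Fin 2 → ℂ, ∀ i j, A i j = u i * w j := by
  rw [Matrix.det_fin_two] at h
  by_cases h0 : A 0 0 = 0 ∧ A 0 1 = 0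
  · exact ⟨![0, 1], A 1, by simp [Fin.forall_fin_two, h0]⟩
  · by_cases h1 : A 0 0 = 0
    · have h2 : A 0 1 ≠ 0 := fun h2 => h0 ⟨h1, h2⟩
      refine ⟨![1, A 1 1 / A 0 1], A 0, ?_⟩
      simp [Fin.forall_fin_two, h1, h2] at h ⊢
      exact h
    · refine ⟨![1, A 1 0 / A 0 0], A 0, ?_⟩
      simp [Fin.forall_fin_two, h1]
      field_simp
      linear_combination h

/-- A rank-one operator would split its party off as a tensor factor. Thus invertibility of local
operators comes for free whenever their output is fully entangled. -/
lemma FullyEntangled.det_ne_zero {M : LocalTriple} {ψ : State 2 2 2}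
    (h : FullyEntangled (MES.op M ψ)) (i : Fin 3) : (M i).det ≠ 0 := by
  intro hi
  obtain ⟨u, w, huw⟩ := exists_rank_one_of_det_eq_zero hi
  obtain ⟨h1, h2, h3⟩ := h
  fin_cases i
  · refine h1 ⟨u, fun j k => ∑ i', ∑ j', ∑ k', w i' * (M 1 j j' * M 2 k k') * ψ (i', j', k'),
      fun i j k => ?_⟩
    simp only [op_apply, Fin.sum_univ_two]
    simp only [Fin.zero_eta] at huw
    simp only [huw]
    ring
  · refine h2 ⟨u, fun i k => ∑ i', ∑ j', ∑ k', w j' * (M 0 i i' * M 2 k k') * ψ (i', j', k'),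
      fun i j k => ?_⟩
    simp only [op_apply, Fin.sum_univ_two]
    simp only [Fin.mk_one] at huw
    simp only [huw]
    ring
  · refine h3 ⟨u, fun i j => ∑ i', ∑ j', ∑ k', w k' * (M 0 i i' * M 1 j j') * ψ (i', j', k'),
      fun i j k => ?_⟩
    simp only [op_apply, Fin.sum_univ_two]
    simp only [Fin.reduceFinMk] at huw
    simp only [huw]
    ring

/-! ### Local unitary equivalence -/

lemma mem_unitary_iff {U : Matrix (Fin 2) (Fin 2) ℂ} :
    U ∈ Matrix.unitaryGroup (Fin 2) ℂ ↔ Uᴴ * U = 1 := Matrix.mem_unitaryGroup_iff'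

lemma luEquiv_iff {ψ φ : State 2 2 2} :
    LUEquiv ψ φ ↔ ∃ U : LocalTriple, (∀ i, (U i)ᴴ * U i = 1) ∧ ∃ c : ℂ, c ≠ 0 ∧
      ψ = c • op U φ := by
  constructor
  · rintro ⟨U₁, h₁, U₂, h₂, U₃, h₃, c, hc, h⟩
    refine ⟨![U₁, U₂, U₃], ?_, c, hc, h⟩
    rw [mem_unitary_iff] at h₁ h₂ h₃
    intro i
    fin_cases i <;> assumption
  · rintro ⟨U, hU, c, hc, h⟩
    exact ⟨U 0, mem_unitary_iff.2 (hU 0), U 1, mem_unitary_iff.2 (hU 1), U 2,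
      mem_unitary_iff.2 (hU 2), c, hc, h⟩

lemma det_ne_zero_of_unitary {U : Matrix (Fin 2) (Fin 2) ℂ} (h : Uᴴ * U = 1) : U.det ≠ 0 := by
  intro h0
  have := congrArg Matrix.det h
  simp [h0] at this

lemma luEquiv_op {U : LocalTriple} (hU : ∀ i, (U i)ᴴ * U i = 1) (ψ : State 2 2 2) :
    LUEquiv (op U ψ) ψ :=
  luEquiv_iff.2 ⟨U, hU, 1, one_ne_zero, by simp⟩

lemma luEquiv_smul {c : ℂ} (hc : c ≠ 0) (ψ : State 2 2 2) : LUEquiv (c • ψ) ψ :=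
  luEquiv_iff.2 ⟨1, by simp, c, hc, by simp [op_one]⟩

lemma LUEquiv.symm {ψ φ : State 2 2 2} (h : LUEquiv ψ φ) : LUEquiv φ ψ := by
  obtain ⟨U, hU, c, hc, rfl⟩ := luEquiv_iff.1 h
  refine luEquiv_iff.2 ⟨fun i => (U i)ᴴ, fun i => ?_, c⁻¹, inv_ne_zero hc, ?_⟩
  · rw [Matrix.conjTranspose_conjTranspose]
    exact mul_eq_one_comm.1 (hU i)
  · have : (fun i => (U i)ᴴ) * U = 1 := by
      ext1 i
      simp [hU i]
    rw [op_smul, op_op, this, op_one, smul_smul, inv_mul_cancel₀ hc, one_smul]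

lemma LUEquiv.trans {ψ φ χ : State 2 2 2} (h : LUEquiv ψ φ) (h' : LUEquiv φ χ) :
    LUEquiv ψ χ := by
  obtain ⟨U, hU, c, hc, rfl⟩ := luEquiv_iff.1 h
  obtain ⟨V, hV, d, hd, rfl⟩ := luEquiv_iff.1 h'
  refine luEquiv_iff.2 ⟨U * V, fun i => ?_, c * d, mul_ne_zero hc hd, ?_⟩
  · rw [Pi.mul_apply, Matrix.conjTranspose_mul, mul_assoc, ← mul_assoc _ (U i), hU, one_mul, hV]
  · rw [op_smul, op_op, smul_smul]

lemma LUEquiv.fullyEntangled {ψ φ : State 2 2 2} (h : LUEquiv ψ φ) (hφ : FullyEntangled φ) :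
    FullyEntangled ψ := by
  obtain ⟨U, hU, c, hc, rfl⟩ := luEquiv_iff.1 h
  exact (hφ.op fun i => det_ne_zero_of_unitary (hU i)).smul hc

/-! ### Composition of LOCC protocols -/

lemma Protocol.Produces.smul {φ : State 2 2 2} {a b c : ℕ} {P : Protocol a b c} {ψ : State a b c}
    (h : P.Produces φ ψ) (z : ℂ) : P.Produces φ (z • ψ) := by
  induction P with
  | finish =>
    obtain ⟨w, rfl⟩ := h
    exact ⟨z * w, by rw [smul_smul]⟩
  | party1 a' K hK next ih => exact fun r => by rw [localOp_smul]; exact ih r (h r)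
  | party2 a' K hK next ih => exact fun r => by rw [localOp_smul]; exact ih r (h r)
  | party3 a' K hK next ih => exact fun r => by rw [localOp_smul]; exact ih r (h r)

/-- Run `P` and then, in every branch, `Q`. -/
def Protocol.append (Q : Protocol 2 2 2) : {a b c : ℕ} → Protocol a b c → Protocol a b c
  | _, _, _, .finish => Q
  | _, _, _, .party1 a' K hK next => .party1 a' K hK fun r => Protocol.append Q (next r)
  | _, _, _, .party2 a' K hK next => .party2 a' K hK fun r => Protocol.append Q (next r)
  | _, _, _, .party3 a' K hK next => .party3 a' K hK fun r => Protocol.append Q (next r)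

lemma Protocol.Produces.append {φ χ : State 2 2 2} {Q : Protocol 2 2 2} (hQ : Q.Produces χ φ)
    {a b c : ℕ} {P : Protocol a b c} {ψ : State a b c} (h : P.Produces φ ψ) :
    (Protocol.append Q P).Produces χ ψ := by
  induction P with
  | finish =>
    obtain ⟨w, rfl⟩ := h
    exact hQ.smul w
  | party1 a' K hK next ih => exact fun r => ih r (h r)
  | party2 a' K hK next ih => exact fun r => ih r (h r)
  | party3 a' K hK next ih => exact fun r => ih r (h r)

lemma LOCCReaches.trans {ψ φ χ : State 2 2 2} (h : LOCCReaches ψ φ) (h' : LOCCReaches φ χ) :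
    LOCCReaches ψ χ := by
  obtain ⟨P, hP⟩ := h
  obtain ⟨Q, hQ⟩ := h'
  exact ⟨Protocol.append Q P, hQ.append hP⟩

lemma loccReaches_smul (z : ℂ) (φ : State 2 2 2) : LOCCReaches (z • φ) φ :=
  ⟨.finish, z, rfl⟩

/-- Party `i` measures first. -/
lemma loccReaches_of_measurement {m : ℕ} (i : Fin 3) (K : Fin m → Matrix (Fin 2) (Fin 2) ℂ)
    (hK : ∑ r, (K r)ᴴ * K r = 1) {ψ φ : State 2 2 2}
    (h : ∀ r, LOCCReaches (op (Function.update 1 i (K r)) ψ) φ) : LOCCReaches ψ φ := by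
  choose P hP using h
  fin_cases i
  · exact ⟨.party1 (fun _ => 2) K hK P, fun r => by simpa [op] using hP r⟩
  · exact ⟨.party2 (fun _ => 2) K hK P, fun r => by simpa [op] using hP r⟩
  · exact ⟨.party3 (fun _ => 2) K hK P, fun r => by simpa [op] using hP r⟩

lemma LUEquiv.loccReaches {ψ φ : State 2 2 2} (h : LUEquiv ψ φ) : LOCCReaches ψ φ := by
  obtain ⟨U, hU, c, hc, rfl⟩ := luEquiv_iff.1 h.symm
  have key : ∀ i (χ : State 2 2 2), LOCCReaches χ (op (Function.update 1 i (U i)) χ) := fun i χ =>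
    loccReaches_of_measurement (m := 1) i (fun _ => U i) (by simp [hU i])
      fun _ => by simpa using loccReaches_smul 1 (op (Function.update 1 i (U i)) χ)
  have h3 := ((key 0 ψ).trans (key 1 _)).trans (key 2 _)
  have h4 := loccReaches_smul c⁻¹ (c • op U ψ)
  rw [smul_smul, inv_mul_cancel₀ hc, one_smul] at h4
  refine LOCCReaches.trans ?_ h4
  convert h3 using 1
  rw [op_op, op_op]
  congr 1
  ext1 i
  fin_cases i <;> simp

/-! ### Faithfulness of one-party operators on a fully entangled state -/

lemma exists_factor_of_dependent {β : Type*} {x : Fin 2 → ℂ} (hx : x ≠ 0) {v : Fin 2 → β → ℂ}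
    (h : ∀ b, x 0 * v 0 b + x 1 * v 1 b = 0) :
    ∃ (f : Fin 2 → ℂ) (g : β → ℂ), ∀ i b, v i b = f i * g b := by
  by_cases h0 : x 0 = 0
  · have h1 : x 1 ≠ 0 := fun h1 => hx (by ext i; fin_cases i <;> simp [h0, h1])
    refine ⟨![1, 0], v 0, fun i b => ?_⟩
    have := h b
    fin_cases i <;> simp_all
  · refine ⟨![-x 1 / x 0, 1], v 1, fun i b => ?_⟩
    have := h b
    fin_cases i
    · simp
      field_simp
      linear_combination this
    · simp

/-- A nonzero row of X would be a linear relation between the two slices of φ along party i, and φ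
would factorise. -/
lemma FullyEntangled.eq_zero_of_op_update_one {φ : State 2 2 2} (hφ : FullyEntangled φ) {i : Fin 3}
    {X : Matrix (Fin 2) (Fin 2) ℂ} (h : MES.op (Function.update 1 i X) φ = 0) : X = 0 := by
  by_contra hX
  obtain ⟨r, hr⟩ : ∃ r, X r ≠ 0 := by
    by_contra! h'
    exact hX (funext h')
  obtain ⟨h1, h2, h3⟩ := hφ
  fin_cases i
  · obtain ⟨f, g, hfg⟩ := exists_factor_of_dependent hr
      (v := fun i (b : Fin 2 × Fin 2) => φ (i, b.1, b.2)) (fun b => by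
        have := congrFun h (r, b.1, b.2)
        simp only [op_apply] at this
        simpa [Matrix.one_apply] using this)
    exact h1 ⟨f, fun j k => g (j, k), fun i j k => hfg i (j, k)⟩
  · obtain ⟨f, g, hfg⟩ := exists_factor_of_dependent hr
      (v := fun i (b : Fin 2 × Fin 2) => φ (b.1, i, b.2)) (fun b => by
        have := congrFun h (b.1, r, b.2)
        simpa [op_apply, Matrix.one_apply] using this)
    exact h2 ⟨f, fun j k => g (j, k), fun i j k => hfg j (i, k)⟩
  · obtain ⟨f, g, hfg⟩ := exists_factor_of_dependent hr
      (v := fun i (b : Fin 2 × Fin 2) => φ (b.1, b.2, i)) (fun b => by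
        have := congrFun h (b.1, b.2, r)
        simpa [op_apply, Matrix.one_apply] using this)
    exact h3 ⟨f, fun j k => g (j, k), fun i j k => hfg k (i, j)⟩

lemma FullyEntangled.eq_zero_of_op_update {φ : State 2 2 2} (hφ : FullyEntangled φ) {i : Fin 3}
    {G : LocalTriple} (hG : ∀ j ≠ i, (G j).det ≠ 0) {X : Matrix (Fin 2) (Fin 2) ℂ}
    (h : MES.op (Function.update G i X) φ = 0) : X = 0 := by
  refine hφ.eq_zero_of_op_update_one (i := i) ?_
  rw [← op_zero (Function.update (fun j => (G j)⁻¹) i 1), ← h, op_op]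
  congr 1
  ext1 j
  by_cases hj : j = i
  · subst hj
    simp
  · simp [hj, Matrix.nonsing_inv_mul _ (hG j hj).isUnit]

/-! ### Rigidity and backward induction over the protocol -/

/-- The positive operators `G` are the Gram operators of a local stabiliser of `φ`. -/
def IsStabilizerGram (φ : State 2 2 2) (G : LocalTriple) : Prop :=
  ∃ (T : LocalTriple) (c : ℂ), c ≠ 0 ∧ op T φ = c • φ ∧ ∀ i, G i = (T i)ᴴ * T i

/-- A local stabiliser of `φ` that is unitary on two of the parties is proportional to a unitary on
the third one. -/
def Rigid (φ : State 2 2 2) : Prop :=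
  ∀ (T : LocalTriple) (c : ℂ), c ≠ 0 → op T φ = c • φ → ∀ i, (∀ j ≠ i, (T j)ᴴ * T j = 1) →
    ∃ l : ℝ, 0 ≤ l ∧ (T i)ᴴ * T i = (l : ℂ) • 1

lemma IsStabilizerGram.smul_update {φ : State 2 2 2} {T : LocalTriple} {c : ℂ} (hc : c ≠ 0)
    (hT : op T φ = c • φ) {i : Fin 3} {G : LocalTriple} (hG : ∀ j ≠ i, G j = (T j)ᴴ * T j)
    {l : ℝ} (hl : 0 < l) : IsStabilizerGram φ (Function.update G i ((l : ℂ) • ((T i)ᴴ * T i))) := by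
  have hs : ((√l : ℝ) : ℂ) * ((√l : ℝ) : ℂ) = l := by
    rw [← Complex.ofReal_mul, Real.mul_self_sqrt hl.le]
  have hs0 : ((√l : ℝ) : ℂ) ≠ 0 := by
    intro h
    rw [h, zero_mul] at hs
    exact hl.ne' (by exact_mod_cast hs.symm)
  refine ⟨fun j => (Function.update (1 : Fin 3 → ℂ) i ((√l : ℝ) : ℂ)) j • T j,
    ((√l : ℝ) : ℂ) * c, mul_ne_zero hs0 hc, ?_, fun j => ?_⟩
  · rw [op_smul_left, hT, smul_smul]
    congr 1
    fin_cases i <;> simp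
  · by_cases hj : j = i
    · subst hj
      beta_reduce
      rw [Function.update_self, Function.update_self, Matrix.conjTranspose_smul, smul_mul_smul_comm,
        Complex.star_def, Complex.conj_ofReal, hs]
    · simp [hj, hG j hj]

/-- The backward step at a measurement of party i: `X r` are the Gram operators of the outcomes and
their sum is the one before the measurement. Since `op` is linear in the slot i, nonvanishing of the
sum gives one nonvanishing outcome, with which all others are compared. -/
lemma Rigid.isStabilizerGram_update_sum {φ : State 2 2 2} (hR : Rigid φ) (hφ : FullyEntangled φ)
    {m : ℕ} (i : Fin 3) (G : LocalTriple) (X : Fin m → Matrix (Fin 2) (Fin 2) ℂ)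
    (hX : ∀ r, op (Function.update G i (X r)) φ ≠ 0 →
      IsStabilizerGram φ (Function.update G i (X r)))
    (hne : op (Function.update G i (∑ r, X r)) φ ≠ 0) :
    IsStabilizerGram φ (Function.update G i (∑ r, X r)) := by
  obtain ⟨r₀, hr₀⟩ : ∃ r, op (Function.update G i (X r)) φ ≠ 0 := by
    by_contra! h
    exact hne (by rw [op_update_sum]; exact Finset.sum_eq_zero fun r _ => h r)
  obtain ⟨T, c, hc, hT, hGT⟩ := hX r₀ hr₀
  have hG : ∀ j ≠ i, G j = (T j)ᴴ * T j := fun j hj => by rw [← hGT j]; simp [hj]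
  have hdet : ∀ j, (T j).det ≠ 0 := fun j =>
    FullyEntangled.det_ne_zero (ψ := φ) (by rw [hT]; exact hφ.smul hc) j
  have key : ∀ r, ∃ l : ℝ, 0 ≤ l ∧ X r = (l : ℂ) • ((T i)ᴴ * T i) := by
    intro r
    -- Outcomes of probability zero have Gram operator zero, because the other two slots are
    -- invertible and φ is fully entangled.
    by_cases hr : op (Function.update G i (X r)) φ = 0
    · refine ⟨0, le_rfl, ?_⟩
      rw [hφ.eq_zero_of_op_update (fun j hj => ?_) hr]
      · simp
      · rw [hG j hj, Matrix.det_mul, Matrix.det_conjTranspose]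
        exact mul_ne_zero (star_ne_zero.2 (hdet j)) (hdet j)
    · obtain ⟨T', c', hc', hT', hGT'⟩ := hX r hr
      have hN : ∀ j, T' j = (T' * fun j => (T j)⁻¹) j * T j := fun j => by
        rw [Pi.mul_apply, mul_assoc, Matrix.nonsing_inv_mul _ (hdet j).isUnit, mul_one]
      have hφ' : op (fun j => (T j)⁻¹) φ = c⁻¹ • φ := by
        have := op_inv_op hdet φ
        rw [hT, op_smul] at this
        conv_rhs => rw [← this]
        rw [smul_smul, inv_mul_cancel₀ hc, one_smul]
      -- T'T⁻¹ stabilises φ and is unitary on the parties other than i, where T and T' have the same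
      -- Gram operator G j.
      obtain ⟨l, hl, h⟩ := hR (T' * fun j => (T j)⁻¹) (c⁻¹ * c') (mul_ne_zero (inv_ne_zero hc) hc')
        (by rw [← op_op, hφ', op_smul, hT', smul_smul]) i (fun j hj => by
          have h1 : (T' j)ᴴ * T' j = (T j)ᴴ * T j := by
            rw [← hG j hj, ← hGT' j]
            simp [hj]
          rw [Pi.mul_apply, Matrix.conjTranspose_mul, mul_assoc, ← mul_assoc _ (T' j), h1,
            mul_assoc, Matrix.mul_nonsing_inv _ (hdet j).isUnit, mul_one,
            ← Matrix.conjTranspose_mul, Matrix.mul_nonsing_inv _ (hdet j).isUnit,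
            Matrix.conjTranspose_one])
      refine ⟨l, hl, ?_⟩
      have h2 := hGT' i
      rw [Function.update_self, hN i, Matrix.conjTranspose_mul, mul_assoc,
        ← mul_assoc _ _ (T i), h] at h2
      simpa using h2
  choose l hl hXl using key
  have hsum : ∑ r, X r = ((∑ r, l r : ℝ) : ℂ) • ((T i)ᴴ * T i) := by
    rw [Complex.ofReal_sum, Finset.sum_smul]
    exact Finset.sum_congr rfl fun r _ => hXl r
  have hpos : 0 < ∑ r, l r := by
    refine lt_of_le_of_ne (Finset.sum_nonneg fun r _ => hl r) fun h0 => hne ?_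
    rw [hsum, ← h0]
    fin_cases i <;> simp [op, localOp]
  rw [hsum]
  exact .smul_update hc hT hG hpos

/-- The Gram operators of a triple of local operators. -/
def gram {a b c : ℕ} (A : Matrix (Fin a) (Fin 2) ℂ) (B : Matrix (Fin b) (Fin 2) ℂ)
    (C : Matrix (Fin c) (Fin 2) ℂ) : LocalTriple :=
  ![Aᴴ * A, Bᴴ * B, Cᴴ * C]

lemma conjTranspose_mul_eq_sum {a d m : ℕ} {a' : Fin m → ℕ}
    {K : (r : Fin m) → Matrix (Fin (a' r)) (Fin a) ℂ} (hK : ∑ r, (K r)ᴴ * K r = 1)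
    (A : Matrix (Fin a) (Fin d) ℂ) : Aᴴ * A = ∑ r, (K r * A)ᴴ * (K r * A) := by
  trans Aᴴ * ((∑ r, (K r)ᴴ * K r) * A)
  · rw [hK, Matrix.one_mul]
  simp only [Matrix.mul_sum, Matrix.sum_mul, Matrix.conjTranspose_mul, Matrix.mul_assoc]

/-- The condition on `op (gram A B C) φ` stands in for positive probability of the branch. It is
linear in each Gram operator, which is what the induction needs. -/
lemma Rigid.isStabilizerGram_of_produces {φ : State 2 2 2} (hR : Rigid φ) (hφ : FullyEntangled φ)
    {a b c : ℕ} (P : Protocol a b c) : ∀ (A : Matrix (Fin a) (Fin 2) ℂ)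
    (B : Matrix (Fin b) (Fin 2) ℂ) (C : Matrix (Fin c) (Fin 2) ℂ),
    P.Produces φ (localOp A B C φ) → op (gram A B C) φ ≠ 0 →
      IsStabilizerGram φ (gram A B C) := by
  induction P with
  | finish =>
    rintro A B C ⟨z, hz⟩ hne
    refine ⟨![A, B, C], z, ?_, hz, fun i => by fin_cases i <;> rfl⟩
    rintro rfl
    refine hne ?_
    have h0 : localOp A B C φ = 0 := by rw [hz, zero_smul]
    change localOp (Aᴴ * A) (Bᴴ * B) (Cᴴ * C) φ = 0
    rw [← localOp_localOp, h0, localOp_zero]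
  | party1 a' K hK next ih =>
    intro A B C hP hne
    have h : ∀ X, ![X, Bᴴ * B, Cᴴ * C] = Function.update (gram A B C) 0 X := fun X => by
      ext1 i; fin_cases i <;> simp [gram]
    rw [gram, h, conjTranspose_mul_eq_sum hK] at hne ⊢
    refine hR.isStabilizerGram_update_sum hφ _ _ _ (fun r hr => ?_) hne
    have := hP r
    rw [localOp_localOp, Matrix.one_mul, Matrix.one_mul] at this
    rw [← h] at hr ⊢
    exact ih r _ _ _ this hr
  | party2 a' K hK next ih =>
    intro A B C hP hne
    have h : ∀ X, ![Aᴴ * A, X, Cᴴ * C] = Function.update (gram A B C) 1 X := fun X => by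
      ext1 i; fin_cases i <;> simp [gram]
    rw [gram, h, conjTranspose_mul_eq_sum hK] at hne ⊢
    refine hR.isStabilizerGram_update_sum hφ _ _ _ (fun r hr => ?_) hne
    have := hP r
    rw [localOp_localOp, Matrix.one_mul, Matrix.one_mul] at this
    rw [← h] at hr ⊢
    exact ih r _ _ _ this hr
  | party3 a' K hK next ih =>
    intro A B C hP hne
    have h : ∀ X, ![Aᴴ * A, Bᴴ * B, X] = Function.update (gram A B C) 2 X := fun X => by
      ext1 i; fin_cases i <;> simp [gram]
    rw [gram, h, conjTranspose_mul_eq_sum hK] at hne ⊢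
    refine hR.isStabilizerGram_update_sum hφ _ _ _ (fun r hr => ?_) hne
    have := hP r
    rw [localOp_localOp, Matrix.one_mul, Matrix.one_mul] at this
    rw [← h] at hr ⊢
    exact ih r _ _ _ this hr

lemma localOp_mul₁ {a b c a' b' c' d : ℕ} (A : Matrix (Fin a') (Fin a) ℂ)
    (B : Matrix (Fin b') (Fin b) ℂ) (C : Matrix (Fin c') (Fin c) ℂ)
    (X : Matrix (Fin d) (Fin a') ℂ) (ψ : State a b c) :
    localOp (X * A) B C ψ = localOp X 1 1 (localOp A B C ψ) := by
  rw [localOp_localOp, Matrix.one_mul, Matrix.one_mul]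

lemma localOp_mul₂ {a b c a' b' c' d : ℕ} (A : Matrix (Fin a') (Fin a) ℂ)
    (B : Matrix (Fin b') (Fin b) ℂ) (C : Matrix (Fin c') (Fin c) ℂ)
    (X : Matrix (Fin d) (Fin b') ℂ) (ψ : State a b c) :
    localOp A (X * B) C ψ = localOp 1 X 1 (localOp A B C ψ) := by
  rw [localOp_localOp, Matrix.one_mul, Matrix.one_mul]

lemma localOp_mul₃ {a b c a' b' c' d : ℕ} (A : Matrix (Fin a') (Fin a) ℂ)
    (B : Matrix (Fin b') (Fin b) ℂ) (C : Matrix (Fin c') (Fin c) ℂ)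
    (X : Matrix (Fin d) (Fin c') ℂ) (ψ : State a b c) :
    localOp A B (X * C) ψ = localOp 1 1 X (localOp A B C ψ) := by
  rw [localOp_localOp, Matrix.one_mul, Matrix.one_mul]

/-- A nonzero state has a branch with nonzero probability. -/
lemma Protocol.Produces.exists_branch {φ : State 2 2 2} {a b c : ℕ} {P : Protocol a b c}
    {ψ : State a b c} (hψ : ψ ≠ 0) (h : P.Produces φ ψ) :
    ∃ (A : Matrix (Fin 2) (Fin a) ℂ) (B : Matrix (Fin 2) (Fin b) ℂ) (C : Matrix (Fin 2) (Fin c) ℂ)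
      (z : ℂ), z ≠ 0 ∧ localOp A B C ψ = z • φ := by
  induction P with
  | finish =>
    obtain ⟨w, rfl⟩ := h
    exact ⟨1, 1, 1, w, fun h => hψ (by rw [h, zero_smul]), localOp_one _⟩
  | party1 a' K hK next ih =>
    obtain ⟨r, hr⟩ : ∃ r, localOp (K r) 1 1 ψ ≠ 0 := by
      by_contra! h0
      refine hψ ?_
      rw [← localOp_one ψ, ← hK, localOp_sum₁]
      refine Finset.sum_eq_zero fun r _ => ?_
      rw [localOp_mul₁, h0, localOp_zero]
    obtain ⟨A, B, C, z, hz, hA⟩ := ih r hr (h r)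
    rw [localOp_localOp] at hA
    exact ⟨_, _, _, z, hz, hA⟩
  | party2 a' K hK next ih =>
    obtain ⟨r, hr⟩ : ∃ r, localOp 1 (K r) 1 ψ ≠ 0 := by
      by_contra! h0
      refine hψ ?_
      rw [← localOp_one ψ, ← hK, localOp_sum₂]
      refine Finset.sum_eq_zero fun r _ => ?_
      rw [localOp_mul₂, h0, localOp_zero]
    obtain ⟨A, B, C, z, hz, hA⟩ := ih r hr (h r)
    rw [localOp_localOp] at hA
    exact ⟨_, _, _, z, hz, hA⟩
  | party3 a' K hK next ih =>
    obtain ⟨r, hr⟩ : ∃ r, localOp 1 1 (K r) ψ ≠ 0 := by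
      by_contra! h0
      refine hψ ?_
      rw [← localOp_one ψ, ← hK, localOp_sum₃]
      refine Finset.sum_eq_zero fun r _ => ?_
      rw [localOp_mul₃, h0, localOp_zero]
    obtain ⟨A, B, C, z, hz, hA⟩ := ih r hr (h r)
    rw [localOp_localOp] at hA
    exact ⟨_, _, _, z, hz, hA⟩

/-- A rigid state can only be obtained by LOCC from the states in its own class. -/
lemma Rigid.luEquiv_of_loccReaches {φ : State 2 2 2} (hR : Rigid φ) (hφ : FullyEntangled φ)
    {ψ : State 2 2 2} (hψ : ψ ≠ 0) (h : LOCCReaches ψ φ) : LUEquiv ψ φ := by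
  obtain ⟨P, hP⟩ := h
  obtain ⟨A, B, C, z, hz, hA⟩ := hP.exists_branch hψ
  have hN : op ![A, B, C] ψ = z • φ := hA
  have hdet := FullyEntangled.det_ne_zero (ψ := ψ) (by rw [hN]; exact hφ.smul hz)
  set N : LocalTriple := fun i => (![A, B, C] i)⁻¹ with hNdef
  have hψN : ψ = z • op N φ := by
    rw [← op_inv_op hdet ψ, hN, op_smul]
  have hNdet : ∀ i, (N i).det ≠ 0 := fun i => by
    rw [hNdef, Matrix.det_nonsing_inv, Ring.inverse_eq_inv']
    exact inv_ne_zero (hdet i)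
  have hP' : P.Produces φ (localOp (N 0) (N 1) (N 2) φ) := by
    have := hP.smul z⁻¹
    rwa [hψN, smul_smul, inv_mul_cancel₀ hz, one_smul] at this
  have hgram : ∀ i, gram (N 0) (N 1) (N 2) i = (N i)ᴴ * N i := fun i => by
    fin_cases i <;> rfl
  obtain ⟨T, c, hc, hT, hG⟩ := hR.isStabilizerGram_of_produces hφ P _ _ _ hP'
    (FullyEntangled.ne_zero (hφ.op fun i => by
      rw [hgram, Matrix.det_mul, Matrix.det_conjTranspose]
      exact mul_ne_zero (star_ne_zero.2 (hNdet i)) (hNdet i)))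
  have hTdet : ∀ i, (T i).det ≠ 0 := fun i =>
    FullyEntangled.det_ne_zero (ψ := φ) (by rw [hT]; exact hφ.smul hc) i
  -- N and T have equal Gram operators, so NT⁻¹ is unitary; T⁻¹ only rescales φ, so NT⁻¹φ is
  -- proportional to Nφ.
  refine luEquiv_iff.2 ⟨N * fun i => (T i)⁻¹, fun i => ?_, z * c, mul_ne_zero hz hc, ?_⟩
  · rw [Pi.mul_apply, Matrix.conjTranspose_mul, mul_assoc, ← mul_assoc _ (N i), ← hgram, hG,
      mul_assoc, Matrix.mul_nonsing_inv _ (hTdet i).isUnit, mul_one,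
      ← Matrix.conjTranspose_mul, Matrix.mul_nonsing_inv _ (hTdet i).isUnit,
      Matrix.conjTranspose_one]
  · have := op_inv_op hTdet φ
    rw [hT, op_smul] at this
    rw [hψN, mul_smul, ← op_op, ← op_smul N c, this]

/-! ### Stabilisers and rigidity in the GHZ class -/

lemma op_ghz_apply (M : LocalTriple) (i j k : Fin 2) : op M ghz (i, j, k) =
    M 0 i 0 * M 1 j 0 * M 2 k 0 + M 0 i 1 * M 1 j 1 * M 2 k 1 := by
  simp [op_apply, ghz, ket, Pi.single_apply, mul_assoc]

lemma diag_or_antidiag {M : Matrix (Fin 2) (Fin 2) ℂ} (hM : M.det ≠ 0)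
    (h0 : M 0 0 * M 0 1 = 0) (h1 : M 1 0 * M 1 1 = 0) :
    (M = !![M 0 0, 0; 0, M 1 1]) ∨ (M = !![0, M 0 1; M 1 0, 0]) := by
  rw [Matrix.det_fin_two] at hM
  rcases mul_eq_zero.1 h0 with h | h
  · right
    rw [h] at hM
    have : M 1 1 = 0 := by
      rcases mul_eq_zero.1 h1 with h' | h'
      · simp [h'] at hM
      · exact h'
    ext i j
    fin_cases i <;> fin_cases j <;> simp [h, this]
  · left
    rw [h] at hM
    have : M 1 0 = 0 := by
      rcases mul_eq_zero.1 h1 with h' | h'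
      · exact h'
      · simp [h'] at hM
    ext i j
    fin_cases i <;> fin_cases j <;> simp [h, this]

/-- The local stabilisers of `|GHZ⟩`. -/
lemma stabilizer_ghz {S : LocalTriple} {c : ℂ} (hc : c ≠ 0) (hS : ∀ i, (S i).det ≠ 0)
    (h : op S ghz = c • ghz) : ∃ s t : Fin 3 → ℂ, s 0 * s 1 * s 2 = c ∧ t 0 * t 1 * t 2 = c ∧
      ((∀ i, S i = !![s i, 0; 0, t i]) ∨ (∀ i, S i = !![0, t i; s i, 0])) := by
  have E : ∀ i j k, S 0 i 0 * S 1 j 0 * S 2 k 0 + S 0 i 1 * S 1 j 1 * S 2 k 1 =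
      c * ghz (i, j, k) := fun i j k => by
    rw [← op_ghz_apply, h, Pi.smul_apply, smul_eq_mul]
  have e000 := E 0 0 0
  have e001 := E 0 0 1
  have e010 := E 0 1 0
  have e011 := E 0 1 1
  have e100 := E 1 0 0
  have e101 := E 1 0 1
  have e110 := E 1 1 0
  have e111 := E 1 1 1
  simp only [ghz, ket, Pi.add_apply, Pi.single_apply, Prod.mk.injEq]
    at e000 e001 e010 e011 e100 e101 e110 e111
  norm_num at e000 e001 e010 e011 e100 e101 e110 e111
  have key : ∀ i, (S i = !![S i 0 0, 0; 0, S i 1 1]) ∨ (S i = !![0, S i 0 1; S i 1 0, 0]) := by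
    have h0 := hS 0
    have h1 := hS 1
    have h2 := hS 2
    intro i
    -- For the row r of party i, the slice of S·GHZ is S_a diag(S_i r 0, S_i r 1) S_bᵀ, with a, b
    -- the other parties; its determinant is S_i r 0 · S_i r 1 · det S_a · det S_b. The same slice
    -- of c·GHZ has rank one, so the two entries of each row of S_i have product zero.
    refine diag_or_antidiag (hS i) ?_ ?_ <;> rw [Matrix.det_fin_two] at h0 h1 h2
    · fin_cases i
      · refine eq_zero_of_ne_zero_of_mul_right_eq_zero (mul_ne_zero h1 h2) ?_
        simp only [Fin.zero_eta]
        linear_combination (S 0 0 0 * S 1 0 0 * S 2 0 0 + S 0 0 1 * S 1 0 1 * S 2 0 1) * e011 -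
          (S 0 0 0 * S 1 1 0 * S 2 0 0 + S 0 0 1 * S 1 1 1 * S 2 0 1) * e001
      · refine eq_zero_of_ne_zero_of_mul_right_eq_zero (mul_ne_zero h0 h2) ?_
        simp only [Fin.mk_one]
        linear_combination (S 0 0 0 * S 1 0 0 * S 2 0 0 + S 0 0 1 * S 1 0 1 * S 2 0 1) * e101 -
          (S 0 1 0 * S 1 0 0 * S 2 0 0 + S 0 1 1 * S 1 0 1 * S 2 0 1) * e001
      · refine eq_zero_of_ne_zero_of_mul_right_eq_zero (mul_ne_zero h0 h1) ?_
        simp only [Fin.reduceFinMk]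
        linear_combination (S 0 0 0 * S 1 0 0 * S 2 0 0 + S 0 0 1 * S 1 0 1 * S 2 0 1) * e110 -
          (S 0 1 0 * S 1 0 0 * S 2 0 0 + S 0 1 1 * S 1 0 1 * S 2 0 1) * e010
    · fin_cases i
      · refine eq_zero_of_ne_zero_of_mul_right_eq_zero (mul_ne_zero h1 h2) ?_
        simp only [Fin.zero_eta]
        linear_combination (S 0 1 0 * S 1 1 0 * S 2 1 0 + S 0 1 1 * S 1 1 1 * S 2 1 1) * e100 -
          (S 0 1 0 * S 1 1 0 * S 2 0 0 + S 0 1 1 * S 1 1 1 * S 2 0 1) * e101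
      · refine eq_zero_of_ne_zero_of_mul_right_eq_zero (mul_ne_zero h0 h2) ?_
        simp only [Fin.mk_one]
        linear_combination (S 0 1 0 * S 1 1 0 * S 2 1 0 + S 0 1 1 * S 1 1 1 * S 2 1 1) * e010 -
          (S 0 1 0 * S 1 1 0 * S 2 0 0 + S 0 1 1 * S 1 1 1 * S 2 0 1) * e011
      · refine eq_zero_of_ne_zero_of_mul_right_eq_zero (mul_ne_zero h0 h1) ?_
        simp only [Fin.reduceFinMk]
        linear_combination (S 0 1 0 * S 1 1 0 * S 2 1 0 + S 0 1 1 * S 1 1 1 * S 2 1 1) * e001 -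
          (S 0 1 0 * S 1 0 0 * S 2 1 0 + S 0 1 1 * S 1 0 1 * S 2 1 1) * e011
  have entries : ∀ i, (S i 0 1 = 0 ∧ S i 1 0 = 0) ∨ (S i 0 0 = 0 ∧ S i 1 1 = 0) := fun i => by
    rcases key i with h | h
    · left; rw [h]; simp
    · right; rw [h]; simp
  -- If diagonal and antidiagonal factors are mixed, the |000⟩ amplitude vanishes, against c ≠ 0.
  rcases entries 0 with h0 | h0 <;> rcases entries 1 with h1 | h1 <;>
    rcases entries 2 with h2 | h2 <;>
    simp only [h0, h1, h2, mul_zero, zero_mul, add_zero, zero_add] at e000 e111 <;>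
    first
      | exact absurd e000.symm hc
      | skip
  · refine ⟨fun i => S i 0 0, fun i => S i 1 1, e000, e111, Or.inl fun i => ?_⟩
    ext a b
    fin_cases i <;> fin_cases a <;> fin_cases b <;> simp [h0, h1, h2]
  · refine ⟨fun i => S i 1 0, fun i => S i 0 1, e111, e000, Or.inr fun i => ?_⟩
    ext a b
    fin_cases i <;> fin_cases a <;> fin_cases b <;> simp [h0, h1, h2]

lemma eq_of_prod_eq {F : Type*} [Field F] {u v : Fin 3 → F} {c : F} (hc : c ≠ 0)
    (hu : u 0 * u 1 * u 2 = c) (hv : v 0 * v 1 * v 2 = c) {i : Fin 3}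
    (h : ∀ j ≠ i, u j = v j) : u i = v i := by
  have h0 : v 0 ≠ 0 := fun h0 => hc (by rw [← hv, h0]; ring)
  have h1 : v 1 ≠ 0 := fun h0 => hc (by rw [← hv, h0]; ring)
  have h2 : v 2 ≠ 0 := fun h0 => hc (by rw [← hv, h0]; ring)
  rw [← hv] at hu
  fin_cases i
  · rw [h 1 (by decide), h 2 (by decide)] at hu
    exact mul_right_cancel₀ h1 (mul_right_cancel₀ h2 hu)
  · rw [h 0 (by decide), h 2 (by decide)] at hu
    exact mul_left_cancel₀ h0 (mul_right_cancel₀ h2 hu)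
  · rw [h 0 (by decide), h 1 (by decide)] at hu
    exact mul_left_cancel₀ (mul_ne_zero h0 h1) hu

lemma gram_diag (s t : ℂ) : (!![s, 0; 0, t])ᴴ * !![s, 0; 0, t] =
    !![(Complex.normSq s : ℂ), 0; 0, (Complex.normSq t : ℂ)] := by
  ext i j
  fin_cases i <;> fin_cases j <;>
    simp [Matrix.mul_apply, Complex.normSq_eq_conj_mul_self]

lemma gram_antidiag (s t : ℂ) : (!![0, t; s, 0])ᴴ * !![0, t; s, 0] =
    !![(Complex.normSq s : ℂ), 0; 0, (Complex.normSq t : ℂ)] := by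
  ext i j
  fin_cases i <;> fin_cases j <;>
    simp [Matrix.mul_apply, Complex.normSq_eq_conj_mul_self]

lemma diag_eq_smul (r : ℝ) : !![(r : ℂ), 0; 0, (r : ℂ)] =
    (r : ℂ) • (1 : Matrix (Fin 2) (Fin 2) ℂ) := by
  ext i j
  fin_cases i <;> fin_cases j <;> simp

lemma fullyEntangled_ghz : FullyEntangled ghz := by
  refine ⟨?_, ?_, ?_⟩ <;>
  · rintro ⟨f, g, h⟩
    have h0 := h 0 0 0
    have h1 := h 1 1 1
    have h2 := h 0 1 1
    have h3 := h 1 0 1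
    have h4 := h 1 1 0
    simp [ghz, ket] at h0 h1 h2 h3 h4
    grind

/-- Unitarity on two parties gives |s| = |t| there; the products of the s and of the t agree, so |s|
= |t| on the third party as well. -/
lemma rigid_ghz : Rigid ghz := by
  intro T c hc hT i hi
  have hdet : ∀ j, (T j).det ≠ 0 := fun j =>
    FullyEntangled.det_ne_zero (ψ := ghz) (by rw [hT]; exact fullyEntangled_ghz.smul hc) j
  obtain ⟨s, t, hs, ht, h⟩ := stabilizer_ghz hc hdet hT
  have hG : ∀ j, (T j)ᴴ * T j =
      !![(Complex.normSq (s j) : ℂ), 0; 0, (Complex.normSq (t j) : ℂ)] := by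
    intro j
    rcases h with h | h
    · rw [h, gram_diag]
    · rw [h, gram_antidiag]
  have heq : Complex.normSq (s i) = Complex.normSq (t i) :=
    eq_of_prod_eq (u := fun j => Complex.normSq (s j)) (v := fun j => Complex.normSq (t j))
      (c := Complex.normSq c) (by simpa using hc) (by rw [← hs]; simp) (by rw [← ht]; simp)
      (fun j hj => by
        have h1 := (hG j).symm.trans (hi j hj)
        have h00 := congrFun₂ h1 0 0
        have h11 := congrFun₂ h1 1 1
        simp only [Matrix.of_apply, Matrix.cons_val', Matrix.cons_val_zero, Matrix.cons_val_one,
          Matrix.cons_val_fin_one, Matrix.one_apply_eq] at h00 h11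
        exact Complex.ofReal_injective (h00.trans h11.symm))
  refine ⟨_, Complex.normSq_nonneg (s i), ?_⟩
  rw [hG i, ← heq, diag_eq_smul]

/-- The positive square root of `[[a, b], [b, a]]`. -/
lemma exists_symm_sqrt {a b : ℝ} (h : |b| < a) :
    ∃ p q : ℝ, |q| < p ∧ p * p + q * q = a ∧ 2 * (p * q) = b := by
  have h1 := abs_lt.1 h
  have e1 := Real.mul_self_sqrt (show 0 ≤ a + b by linarith)
  have e2 := Real.mul_self_sqrt (show 0 ≤ a - b by linarith)
  have p1 := Real.sqrt_pos.2 (show 0 < a + b by linarith)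
  have p2 := Real.sqrt_pos.2 (show 0 < a - b by linarith)
  refine ⟨(√(a + b) + √(a - b)) / 2, (√(a + b) - √(a - b)) / 2, ?_, ?_, ?_⟩
  · rw [abs_lt]
    constructor <;> linarith
  · linear_combination e1 / 2 + e2 / 2
  · linear_combination e1 / 2 - e2 / 2

lemma isNontrivialGx_iff {g : Matrix (Fin 2) (Fin 2) ℂ} : IsNontrivialGx g ↔
    ∃ p q : ℝ, q ≠ 0 ∧ |q| < p ∧ g = !![(p : ℂ), (q : ℂ); (q : ℂ), (p : ℂ)] := by
  constructor
  · rintro ⟨hg, hpos, hne⟩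
    obtain ⟨x, y, rfl⟩ := Submodule.mem_span_pair.1 hg
    have hherm := hpos.isHermitian
    have hd := hpos.det_pos
    have h0 := hpos.diag_pos (i := 0)
    have hx := congrFun₂ hherm 0 0
    have hy := congrFun₂ hherm 0 1
    simp [pauliX, Complex.conj_eq_iff_real] at hx hy h0
    obtain ⟨p, rfl⟩ := hx
    obtain ⟨q, rfl⟩ := hy
    refine ⟨p, q, ?_, ?_, ?_⟩
    · rintro rfl
      exact hne ⟨p, by simp⟩
    · have hp : 0 < p := by exact_mod_cast h0
      simp [pauliX, Matrix.det_fin_two] at hd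
      have hd' : q * q < p * p := by exact_mod_cast hd
      exact abs_lt_of_sq_lt_sq (by nlinarith) hp.le
    · ext i j
      fin_cases i <;> fin_cases j <;> simp [pauliX]
  · rintro ⟨p, q, hq, hpq, rfl⟩
    refine ⟨Submodule.mem_span_pair.2 ⟨p, q, ?_⟩, ?_, ?_⟩
    · ext i j
      fin_cases i <;> fin_cases j <;> simp [pauliX]
    · obtain ⟨a, b, hab, hp, hq'⟩ := exists_symm_sqrt hpq
      have : !![(p : ℂ), (q : ℂ); (q : ℂ), (p : ℂ)] =
          (!![(a : ℂ), (b : ℂ); (b : ℂ), (a : ℂ)])ᴴ * !![(a : ℂ), (b : ℂ); (b : ℂ), (a : ℂ)] := by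
        ext i j
        fin_cases i <;> fin_cases j <;> simp [Matrix.mul_apply, ← hp, ← hq'] <;> ring
      rw [this]
      have hu : IsUnit !![(a : ℂ), (b : ℂ); (b : ℂ), (a : ℂ)] := by
        rw [Matrix.isUnit_iff_isUnit_det, Matrix.det_fin_two, isUnit_iff_ne_zero]
        have : a * a - b * b ≠ 0 := by
          have := abs_lt.1 hab
          have : 0 < (a - b) * (a + b) := mul_pos (by linarith) (by linarith)
          nlinarith
        simpa using (by exact_mod_cast this : (a : ℂ) * a - b * b ≠ 0)
      exact Matrix.PosDef.conjTranspose_mul_self _ (Matrix.mulVec_injective_of_isUnit hu)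
    · rintro ⟨z, hz⟩
      have := congrFun₂ hz 0 1
      simp at this
      exact hq this

lemma IsNontrivialGx.det_ne_zero {g : Matrix (Fin 2) (Fin 2) ℂ} (h : IsNontrivialGx g) :
    g.det ≠ 0 := h.2.1.det_pos.ne'

/-- Conjugation by g turns T into a stabiliser S of GHZ. Where T is unitary, S preserves gᴴg; its
nonzero off-diagonal entry pins down the relative phase and forces s = t. Equality of products
passes this on to party i, where S is then a multiple of 1 or X, commutes with g, and equals T. -/
lemma rigid_op_ghz {g : LocalTriple} (hg : ∀ i, IsNontrivialGx (g i)) : Rigid (op g ghz) := by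
  intro T c hc hT i hi
  have hgdet : ∀ j, (g j).det ≠ 0 := fun j => (hg j).det_ne_zero
  have hφ : FullyEntangled (op g ghz) := fullyEntangled_ghz.op hgdet
  set S : LocalTriple := (fun j => (g j)⁻¹) * (T * g) with hSdef
  have hTS : ∀ j, T j * g j = g j * S j := fun j => by
    rw [hSdef, Pi.mul_apply, Pi.mul_apply, ← mul_assoc,
      Matrix.mul_nonsing_inv _ (hgdet j).isUnit, one_mul]
  have hS : op S ghz = c • ghz := by
    rw [hSdef, ← op_op, ← op_op, hT, op_smul, op_inv_op hgdet]
  have hSdet : ∀ j, (S j).det ≠ 0 := fun j =>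
    FullyEntangled.det_ne_zero (ψ := ghz) (by rw [hS]; exact fullyEntangled_ghz.smul hc) j
  obtain ⟨s, t, hs, ht, h⟩ := stabilizer_ghz hc hSdet hS
  have heq : s i = t i := by
    refine eq_of_prod_eq hc hs ht fun j hj => ?_
    obtain ⟨p, q, hq, hpq, hgj⟩ := isNontrivialGx_iff.1 (hg j)
    have h1 : (S j)ᴴ * ((g j)ᴴ * g j) * S j = (g j)ᴴ * g j := by
      calc (S j)ᴴ * ((g j)ᴴ * g j) * S j = (g j * S j)ᴴ * (g j * S j) := by
            simp only [Matrix.conjTranspose_mul, mul_assoc]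
        _ = (g j)ᴴ * ((T j)ᴴ * T j) * g j := by
            rw [← hTS]
            simp only [Matrix.conjTranspose_mul, mul_assoc]
        _ = _ := by rw [hi j hj, mul_one]
    have hp : p ≠ 0 := ((abs_nonneg q).trans_lt hpq).ne'
    have hp' : (p : ℂ) ≠ 0 := by exact_mod_cast hp
    have hq' : (q : ℂ) ≠ 0 := by exact_mod_cast hq
    have hP : (p : ℂ) * p + q * q ≠ 0 := by
      have : p * p + q * q ≠ 0 :=
        (add_pos_of_pos_of_nonneg (mul_self_pos.2 hp) (mul_self_nonneg q)).ne'
      exact_mod_cast this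
    have hQ : (p : ℂ) * q + q * p ≠ 0 := by
      have : (p : ℂ) * q + q * p = 2 * (p * q) := by ring
      rw [this]
      simp [hp', hq']
    have hgg : (g j)ᴴ * g j =
        !![(p : ℂ) * p + q * q, p * q + q * p; p * q + q * p, p * p + q * q] := by
      rw [hgj]
      ext a b
      fin_cases a <;> fin_cases b <;> simp [Matrix.mul_apply] <;> ring
    rw [hgg] at h1
    have h00 := congrFun₂ h1 0 0
    have h01 := congrFun₂ h1 0 1
    have h10 := congrFun₂ h1 1 0
    rcases h with h | h <;> rw [h j] at h00 h01 h10 <;>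
      simp [Matrix.mul_apply] at h00 h01 h10 <;>
      generalize (p : ℂ) * p + q * q = P at * <;>
      generalize (p : ℂ) * q + q * p = Q at *
    -- The diagonal entry P of gᴴg gives |s|² = 1 and the off-diagonal entry Q ≠ 0 gives s̄t = 1.
    · have n1 : (starRingEnd ℂ) (s j) * s j = 1 :=
        mul_right_cancel₀ hP (by linear_combination h00)
      have n2 : (starRingEnd ℂ) (s j) * t j = 1 :=
        mul_right_cancel₀ hQ (by linear_combination h01)
      exact mul_left_cancel₀ (left_ne_zero_of_mul_eq_one n1) (n1.trans n2.symm)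
    · have n1 : (starRingEnd ℂ) (s j) * s j = 1 :=
        mul_right_cancel₀ hP (by linear_combination h00)
      have n2 : (starRingEnd ℂ) (s j) * t j = 1 :=
        mul_right_cancel₀ hQ (by linear_combination h01)
      exact mul_left_cancel₀ (left_ne_zero_of_mul_eq_one n1) (n1.trans n2.symm)
  have hcomm : g i * S i = S i * g i := by
    obtain ⟨p, q, -, -, hgi⟩ := isNontrivialGx_iff.1 (hg i)
    rcases h with h | h <;> rw [h i, hgi, heq] <;> ext a b <;> fin_cases a <;> fin_cases b <;>
      simp [mul_comm]
  have hTi : T i = S i := by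
    have := hTS i
    rw [hcomm] at this
    exact ((Matrix.isUnit_iff_isUnit_det _).2 (hgdet i).isUnit).mul_right_cancel this
  refine ⟨_, Complex.normSq_nonneg (t i), ?_⟩
  rw [hTi, ← diag_eq_smul]
  rcases h with h | h
  · rw [h i, gram_diag, heq]
  · rw [h i, gram_antidiag, heq]

/-! ### Rigidity in the W class -/

/-- The states `w |000⟩ + x₀ |100⟩ + x₁ |010⟩ + x₂ |001⟩`. -/
noncomputable def wLike (w : ℂ) (x : Fin 3 → ℂ) : State 2 2 2 :=
  w • ket 0 0 0 + x 0 • ket 1 0 0 + x 1 • ket 0 1 0 + x 2 • ket 0 0 1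

lemma op_wLike_apply (M : LocalTriple) (w : ℂ) (x : Fin 3 → ℂ) (i j k : Fin 2) :
    op M (wLike w x) (i, j, k) =
      w * (M 0 i 0 * M 1 j 0 * M 2 k 0) + x 0 * (M 0 i 1 * M 1 j 0 * M 2 k 0) +
      x 1 * (M 0 i 0 * M 1 j 1 * M 2 k 0) + x 2 * (M 0 i 0 * M 1 j 0 * M 2 k 1) := by
  simp [op_apply, wLike, ket, Pi.single_apply]
  ring

lemma fullyEntangled_wLike (w : ℂ) {x : Fin 3 → ℂ} (hx : ∀ i, x i ≠ 0) :
    FullyEntangled (wLike w x) := by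
  have hx0 := hx 0
  have hx1 := hx 1
  have hx2 := hx 2
  refine ⟨?_, ?_, ?_⟩ <;>
  · rintro ⟨f, g, h⟩
    have h0 := h 0 0 0
    have h1 := h 0 0 1
    have h2 := h 0 1 0
    have h3 := h 1 0 0
    have h4 := h 0 1 1
    have h5 := h 1 0 1
    have h6 := h 1 1 0
    simp [wLike, ket] at h0 h1 h2 h3 h4 h5 h6
    grind

lemma eq_diag_of_unitary {M : Matrix (Fin 2) (Fin 2) ℂ} (h : Mᴴ * M = 1) (h0 : M 1 0 = 0) :
    M 0 1 = 0 ∧ Complex.normSq (M 0 0) = 1 ∧ Complex.normSq (M 1 1) = 1 := by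
  have h00 := congrFun₂ h 0 0
  have h01 := congrFun₂ h 0 1
  have h11 := congrFun₂ h 1 1
  simp [Matrix.mul_apply, h0] at h00 h01 h11
  have hne : M 0 0 ≠ 0 := right_ne_zero_of_mul_eq_one h00
  have h1 : M 0 1 = 0 := h01.resolve_left hne
  rw [h1, mul_zero, zero_add] at h11
  refine ⟨h1, ?_, ?_⟩ <;> apply Complex.ofReal_injective <;>
    rw [Complex.normSq_eq_conj_mul_self] <;> simpa

/-- Stabilisers are upper triangular, so where they are unitary they are diagonal with unimodular
entries. The |000⟩ amplitude then kills the remaining off-diagonal entry, and the other amplitudes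
give both diagonal entries on party i the modulus |c|. -/
lemma rigid_wLike {x : Fin 3 → ℂ} (hx : ∀ i, x i ≠ 0) : Rigid (wLike 0 x) := by
  intro T c hc hT i hi
  have hφ := fullyEntangled_wLike 0 hx
  have hdet : ∀ j, (T j).det ≠ 0 := fun j =>
    FullyEntangled.det_ne_zero (ψ := wLike 0 x) (by rw [hT]; exact hφ.smul hc) j
  have E : ∀ i j k, x 0 * (T 0 i 1 * T 1 j 0 * T 2 k 0) +
      x 1 * (T 0 i 0 * T 1 j 1 * T 2 k 0) + x 2 * (T 0 i 0 * T 1 j 0 * T 2 k 1) =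
      c * wLike 0 x (i, j, k) := fun i j k => by
    rw [← smul_eq_mul c, ← Pi.smul_apply, ← hT, op_wLike_apply]
    ring
  have e000 := E 0 0 0
  have e001 := E 0 0 1
  have e010 := E 0 1 0
  have e011 := E 0 1 1
  have e100 := E 1 0 0
  have e101 := E 1 0 1
  have e110 := E 1 1 0
  have e111 := E 1 1 1
  simp only [wLike, ket, Pi.add_apply, Pi.smul_apply, Pi.single_apply, Prod.mk.injEq]
    at e000 e001 e010 e011 e100 e101 e110 e111
  norm_num at e000 e001 e010 e011 e100 e101 e110 e111
  have hlow : ∀ j, T j 1 0 = 0 := by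
    have h0 := hdet 0
    have h1 := hdet 1
    have h2 := hdet 2
    rw [Matrix.det_fin_two] at h0 h1 h2
    intro j
    -- The slice with index 1 for party j has determinant −x_a x_b (T_j 1 0)² det T_a det T_b, with
    -- a, b the other parties. In c·`wLike 0 x` this slice has a single nonzero entry, so the
    -- determinant is zero.
    refine pow_eq_zero_iff (two_ne_zero) |>.1 ?_
    fin_cases j
    · refine eq_zero_of_ne_zero_of_mul_right_eq_zero
        (mul_ne_zero (mul_ne_zero (hx 1) (hx 2)) (mul_ne_zero h1 h2)) ?_
      simp only [Fin.zero_eta]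
      linear_combination (x 0 * (T 0 1 1 * T 1 0 0 * T 2 1 0) +
        x 1 * (T 0 1 0 * T 1 0 1 * T 2 1 0) + x 2 * (T 0 1 0 * T 1 0 0 * T 2 1 1)) * e110 -
        (x 0 * (T 0 1 1 * T 1 0 0 * T 2 0 0) +
        x 1 * (T 0 1 0 * T 1 0 1 * T 2 0 0) + x 2 * (T 0 1 0 * T 1 0 0 * T 2 0 1)) * e111
    · refine eq_zero_of_ne_zero_of_mul_right_eq_zero
        (mul_ne_zero (mul_ne_zero (hx 0) (hx 2)) (mul_ne_zero h0 h2)) ?_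
      simp only [Fin.mk_one]
      linear_combination (x 0 * (T 0 0 1 * T 1 1 0 * T 2 1 0) +
        x 1 * (T 0 0 0 * T 1 1 1 * T 2 1 0) + x 2 * (T 0 0 0 * T 1 1 0 * T 2 1 1)) * e110 -
        (x 0 * (T 0 0 1 * T 1 1 0 * T 2 0 0) +
        x 1 * (T 0 0 0 * T 1 1 1 * T 2 0 0) + x 2 * (T 0 0 0 * T 1 1 0 * T 2 0 1)) * e111
    · refine eq_zero_of_ne_zero_of_mul_right_eq_zero
        (mul_ne_zero (mul_ne_zero (hx 0) (hx 1)) (mul_ne_zero h0 h1)) ?_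
      simp only [Fin.reduceFinMk]
      linear_combination (x 0 * (T 0 0 1 * T 1 1 0 * T 2 1 0) +
        x 1 * (T 0 0 0 * T 1 1 1 * T 2 1 0) + x 2 * (T 0 0 0 * T 1 1 0 * T 2 1 1)) * e101 -
        (x 0 * (T 0 0 1 * T 1 0 0 * T 2 1 0) +
        x 1 * (T 0 0 0 * T 1 0 1 * T 2 1 0) + x 2 * (T 0 0 0 * T 1 0 0 * T 2 1 1)) * e111
  have hd : ∀ j, T j 0 0 ≠ 0 := fun j h => hdet j (by rw [Matrix.det_fin_two, h, hlow j]; ring)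
  have hx0 := hx 0
  have hx1 := hx 1
  have hx2 := hx 2
  have hd0 := hd 0
  have hd1 := hd 1
  have hd2 := hd 2
  simp only [hlow, mul_zero, zero_mul, add_zero, zero_add] at e100 e010 e001
  have f0 : T 0 1 1 * T 1 0 0 * T 2 0 0 = c := mul_left_cancel₀ hx0 (by linear_combination e100)
  have f1 : T 0 0 0 * T 1 1 1 * T 2 0 0 = c := mul_left_cancel₀ hx1 (by linear_combination e010)
  have f2 : T 0 0 0 * T 1 0 0 * T 2 1 1 = c := mul_left_cancel₀ hx2 (by linear_combination e001)
  have n0 := congrArg Complex.normSq f0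
  have n1 := congrArg Complex.normSq f1
  have n2 := congrArg Complex.normSq f2
  simp only [Complex.normSq_mul] at n0 n1 n2
  have hU : ∀ j ≠ i, T j 0 1 = 0 ∧ Complex.normSq (T j 0 0) = 1 ∧ Complex.normSq (T j 1 1) = 1 :=
    fun j hj => eq_diag_of_unitary (hi j hj) (hlow j)
  have key : T i 0 1 = 0 ∧ Complex.normSq (T i 0 0) = Complex.normSq c ∧
      Complex.normSq (T i 1 1) = Complex.normSq c := by
    fin_cases i
    · obtain ⟨a1, b1, c1⟩ := hU 1 (by decide)
      obtain ⟨a2, b2, c2⟩ := hU 2 (by decide)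
      simp_all
    · obtain ⟨a1, b1, c1⟩ := hU 0 (by decide)
      obtain ⟨a2, b2, c2⟩ := hU 2 (by decide)
      simp_all
    · obtain ⟨a1, b1, c1⟩ := hU 0 (by decide)
      obtain ⟨a2, b2, c2⟩ := hU 1 (by decide)
      simp_all
  refine ⟨_, Complex.normSq_nonneg c, ?_⟩
  have : T i = !![T i 0 0, 0; 0, T i 1 1] := by
    ext a b
    fin_cases a <;> fin_cases b <;> simp [key.1, hlow i]
  rw [this, gram_diag, key.2.1, key.2.2, diag_eq_smul]

/-! ### The two classes under invertible local operators -/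

/-- The pencil φ₀ + yφ₁ of the slices along the first party has a singular member: det(φ₀ + yφ₁) is
quadratic in y, and if its leading coefficient det φ₁ is zero, then φ₁ itself serves after a swap.
-/
lemma exists_det_slice_eq_zero (φ : State 2 2 2) : ∃ A : Matrix (Fin 2) (Fin 2) ℂ, A.det ≠ 0 ∧
    (Matrix.of fun j k => localOp (c' := 2) (b' := 2) A 1 1 φ (0, j, k)).det = 0 := by
  by_cases h : φ (1, 0, 0) * φ (1, 1, 1) - φ (1, 0, 1) * φ (1, 1, 0) = 0
  · refine ⟨!![0, 1; 1, 0], by simp [Matrix.det_fin_two], ?_⟩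
    simp [Matrix.det_fin_two, localOp_apply, Matrix.one_apply]
    exact h
  · obtain ⟨y, hy⟩ := exists_quadratic_eq_zero
      (b := φ (0, 0, 0) * φ (1, 1, 1) + φ (1, 0, 0) * φ (0, 1, 1) - φ (0, 0, 1) * φ (1, 1, 0) -
        φ (1, 0, 1) * φ (0, 1, 0)) (c := φ (0, 0, 0) * φ (0, 1, 1) - φ (0, 0, 1) * φ (0, 1, 0)) h
      (IsAlgClosed.exists_eq_mul_self _)
    refine ⟨!![1, y; 0, 1], by simp [Matrix.det_fin_two], ?_⟩
    simp [Matrix.det_fin_two, localOp_apply, Matrix.one_apply]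
    linear_combination hy

lemma exists_mul_eq_basis {u : Fin 2 → ℂ} (hu : u ≠ 0) : ∃ B : Matrix (Fin 2) (Fin 2) ℂ,
    B.det ≠ 0 ∧ B 0 0 * u 0 + B 0 1 * u 1 = 1 ∧ B 1 0 * u 0 + B 1 1 * u 1 = 0 := by
  by_cases h0 : u 0 = 0
  · have h1 : u 1 ≠ 0 := fun h1 => hu (by ext i; fin_cases i <;> simp [h0, h1])
    exact ⟨!![0, (u 1)⁻¹; 1, 0], by simp [Matrix.det_fin_two, h1], by simp [h1], by simp [h0]⟩
  · refine ⟨!![(u 0)⁻¹, 0; -u 1, u 0], by simp [Matrix.det_fin_two, h0], by simp [h0], ?_⟩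
    simp
    ring

/-- Every state of the form `|000⟩ + |1⟩ ⊗ N` is obtained from `|GHZ⟩` or `|W⟩` by local
operators. -/
lemma exists_op_of_slice {χ : State 2 2 2} (h : χ (0, 0, 0) = 1) (h1 : χ (0, 0, 1) = 0)
    (h2 : χ (0, 1, 0) = 0) (h3 : χ (0, 1, 1) = 0) :
    ∃ M, χ = op M ghz ∨ χ = op M (wLike 0 1) := by
  by_cases hs : χ (1, 1, 1) = 0
  · refine ⟨![!![0, 1; 1, χ (1, 0, 0)], !![1, 0; 0, χ (1, 1, 0)], !![1, 0; 0, χ (1, 0, 1)]],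
      Or.inr ?_⟩
    ext ⟨i, j, k⟩
    rw [op_wLike_apply]
    fin_cases i <;> fin_cases j <;> fin_cases k <;> simp [h, h1, h2, h3, hs]
  -- Schur complement: N is a multiple of |00⟩ plus N₁₁ b ⊗ c, where b = (N₀₁/N₁₁, 1) and c =
  -- (N₁₀/N₁₁, 1).
  · refine ⟨![!![1, 0; χ (1, 0, 0) - χ (1, 0, 1) * χ (1, 1, 0) / χ (1, 1, 1), χ (1, 1, 1)],
      !![1, χ (1, 0, 1) / χ (1, 1, 1); 0, 1], !![1, χ (1, 1, 0) / χ (1, 1, 1); 0, 1]], Or.inl ?_⟩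
    ext ⟨i, j, k⟩
    rw [op_ghz_apply]
    fin_cases i <;> fin_cases j <;> fin_cases k <;> simp [h, h1, h2, h3] <;> field_simp <;> ring

/-- The two classes of fully entangled three-qubit states under invertible local operators. -/
lemma FullyEntangled.exists_eq_op {φ : State 2 2 2} (hφ : FullyEntangled φ) :
    ∃ M, φ = MES.op M ghz ∨ φ = MES.op M (wLike 0 1) := by
  obtain ⟨A, hA, hdet⟩ := exists_det_slice_eq_zero φ
  have hAdet : ∀ i, ((![A, 1, 1] : LocalTriple) i).det ≠ 0 := fun i => by
    fin_cases i <;> simp [hA]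
  obtain ⟨u, w, huw⟩ := exists_rank_one_of_det_eq_zero hdet
  change ∀ j k, MES.op ![A, 1, 1] φ (0, j, k) = u j * w k at huw
  have hχ : FullyEntangled (MES.op ![A, 1, 1] φ) := hφ.op hAdet
  have hφχ := op_inv_op hAdet φ
  generalize MES.op ![A, 1, 1] φ = χ at huw hχ hφχ
  have hne : ¬ ∀ j k, χ (0, j, k) = 0 := fun h0 =>
    hχ.1 ⟨![0, 1], fun j k => χ (1, j, k), by simp [Fin.forall_fin_two, h0]⟩
  have hu : u ≠ 0 := fun h => hne fun j k => by simp [huw, h]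
  have hw : w ≠ 0 := fun h => hne fun j k => by simp [huw, h]
  obtain ⟨B, hB, hB0, hB1⟩ := exists_mul_eq_basis hu
  obtain ⟨C, hC, hC0, hC1⟩ := exists_mul_eq_basis hw
  have hBdet : ∀ i, ((![1, B, C] : LocalTriple) i).det ≠ 0 := fun i => by
    fin_cases i <;> simp [hB, hC]
  have hval : ∀ j k, MES.op ![1, B, C] χ (0, j, k) =
      (B j 0 * u 0 + B j 1 * u 1) * (C k 0 * w 0 + C k 1 * w 1) := fun j k => by
    change localOp 1 B C χ (0, j, k) = _
    simp [localOp_apply, Matrix.one_apply, huw]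
    ring
  obtain ⟨M, hM⟩ := exists_op_of_slice (χ := MES.op ![1, B, C] χ) (by simp [hval, hB0, hC0])
    (by simp [hval, hC1]) (by simp [hval, hB1]) (by simp [hval, hB1])
  have hχB := op_inv_op hBdet χ
  rcases hM with hM | hM
  · exact ⟨_, Or.inl (by rw [← hφχ, ← hχB, hM, op_op, op_op])⟩
  · exact ⟨_, Or.inr (by rw [← hφχ, ← hχB, hM, op_op, op_op])⟩

/-! ### Normal form and protocol in the W class -/

lemma exists_unitary_mul_of_gram_eq {M N : Matrix (Fin 2) (Fin 2) ℂ} (hN : N.det ≠ 0)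
    (h : Mᴴ * M = Nᴴ * N) : ∃ U : Matrix (Fin 2) (Fin 2) ℂ, Uᴴ * U = 1 ∧ M = U * N := by
  refine ⟨M * N⁻¹, ?_, ?_⟩
  · rw [Matrix.conjTranspose_mul, mul_assoc, ← mul_assoc _ M, h, mul_assoc,
      Matrix.mul_nonsing_inv _ hN.isUnit, mul_one, ← Matrix.conjTranspose_mul,
      Matrix.mul_nonsing_inv _ hN.isUnit, Matrix.conjTranspose_one]
  · rw [mul_assoc, Matrix.nonsing_inv_mul _ hN.isUnit, mul_one]

lemma ofReal_sqrt_mul_self {r : ℝ} (hr : 0 ≤ r) : ((√r : ℝ) : ℂ) * ((√r : ℝ) : ℂ) = r := by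
  rw [← Complex.ofReal_mul, Real.mul_self_sqrt hr]

lemma ofReal_sqrt_ne_zero {r : ℝ} (hr : 0 < r) : ((√r : ℝ) : ℂ) ≠ 0 :=
  Complex.ofReal_ne_zero.2 (Real.sqrt_ne_zero'.2 hr)

/-- Left multiplication by a unitary makes a matrix upper triangular. -/
lemma exists_unitary_mul_apply_one_zero {M : Matrix (Fin 2) (Fin 2) ℂ} (hM : M.det ≠ 0) :
    ∃ U : Matrix (Fin 2) (Fin 2) ℂ, Uᴴ * U = 1 ∧ (U * M) 1 0 = 0 := by
  have hpos : 0 < Complex.normSq (M 0 0) + Complex.normSq (M 1 0) := by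
    refine (add_nonneg (Complex.normSq_nonneg _) (Complex.normSq_nonneg _)).lt_of_ne' fun h => hM ?_
    have h0 : M 0 0 = 0 := Complex.normSq_eq_zero.1 (by
      linarith [Complex.normSq_nonneg (M 0 0), Complex.normSq_nonneg (M 1 0)])
    have h1 : M 1 0 = 0 := Complex.normSq_eq_zero.1 (by
      linarith [Complex.normSq_nonneg (M 0 0), Complex.normSq_nonneg (M 1 0)])
    rw [Matrix.det_fin_two, h0, h1]
    ring
  set n := ((√(Complex.normSq (M 0 0) + Complex.normSq (M 1 0)) : ℝ) : ℂ) with hn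
  have hn0 : n ≠ 0 := ofReal_sqrt_ne_zero hpos
  have hnn : n * n = star (M 0 0) * M 0 0 + star (M 1 0) * M 1 0 := by
    rw [hn, ofReal_sqrt_mul_self hpos.le, Complex.ofReal_add, Complex.normSq_eq_conj_mul_self,
      Complex.normSq_eq_conj_mul_self]
    rfl
  have hns : star n = n := Complex.conj_ofReal _
  refine ⟨n⁻¹ • !![star (M 0 0), star (M 1 0); -M 1 0, M 0 0], ?_, ?_⟩
  · rw [mul_eq_one_comm, Matrix.conjTranspose_smul, star_inv₀, hns, smul_mul_smul_comm]
    have : n⁻¹ * n⁻¹ * (star (M 0 0) * M 0 0 + star (M 1 0) * M 1 0) = 1 := by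
      rw [← hnn]
      field_simp
    ext i j
    rw [Matrix.smul_apply, Matrix.mul_apply, Fin.sum_univ_two]
    fin_cases i <;> fin_cases j <;> simp at this ⊢ <;>
      first
        | linear_combination this
        | (right; ring)
  · simp [Matrix.mul_apply]
    ring

lemma op_wLike_of_upper {M : LocalTriple} (hM : ∀ i, M i 1 0 = 0) (x : Fin 3 → ℂ) :
    op M (wLike 0 x) = wLike
      (x 0 * (M 0 0 1 * M 1 0 0 * M 2 0 0) + x 1 * (M 0 0 0 * M 1 0 1 * M 2 0 0) +
        x 2 * (M 0 0 0 * M 1 0 0 * M 2 0 1))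
      ![x 0 * (M 0 1 1 * M 1 0 0 * M 2 0 0), x 1 * (M 0 0 0 * M 1 1 1 * M 2 0 0),
        x 2 * (M 0 0 0 * M 1 0 0 * M 2 1 1)] := by
  ext ⟨i, j, k⟩
  rw [op_wLike_apply]
  fin_cases i <;> fin_cases j <;> fin_cases k <;> simp [hM, wLike, ket]

/-- Every state of the W class is LU equivalent to some `wLike w x`. -/
lemma exists_luEquiv_wLike {M : LocalTriple} (hM : ∀ i, (M i).det ≠ 0) :
    ∃ (w : ℂ) (x : Fin 3 → ℂ), (∀ i, x i ≠ 0) ∧ LUEquiv (op M (wLike 0 1)) (wLike w x) := by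
  choose U hU hUM using fun i => exists_unitary_mul_apply_one_zero (hM i)
  have hdet : ∀ i, (U * M) i 0 0 ≠ 0 ∧ (U * M) i 1 1 ≠ 0 := fun i => by
    have : ((U * M) i).det ≠ 0 := by
      rw [Pi.mul_apply, Matrix.det_mul]
      exact mul_ne_zero (det_ne_zero_of_unitary (hU i)) (hM i)
    rw [Matrix.det_fin_two, show (U * M) i 1 0 = 0 from hUM i, mul_zero, sub_zero] at this
    exact mul_ne_zero_iff.1 this
  have h := luEquiv_op hU (op M (wLike 0 1))
  rw [op_op, op_wLike_of_upper (M := U * M) hUM] at h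
  refine ⟨_, _, fun i => ?_, h.symm⟩
  fin_cases i <;> simp [-Pi.mul_apply, hdet]

lemma op_update_smul (M : LocalTriple) (i : Fin 3) (z : ℂ) (X : Matrix (Fin 2) (Fin 2) ℂ)
    (ψ : State 2 2 2) :
    op (Function.update M i (z • X)) ψ = z • op (Function.update M i X) ψ := by
  fin_cases i <;> simp [op, localOp, Matrix.smul_kronecker, Matrix.kronecker_smul,
    Matrix.smul_mulVec]

lemma wLike_neg_luEquiv (w : ℂ) (x : Fin 3 → ℂ) : LUEquiv (wLike (-w) x) (wLike w x) := by
  refine luEquiv_iff.2 ⟨fun _ => !![1, 0; 0, -1], fun i => ?_, -1, by simp, ?_⟩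
  · ext i j
    fin_cases i <;> fin_cases j <;> simp [Matrix.mul_apply]
  · ext ⟨i, j, k⟩
    rw [Pi.smul_apply, op_wLike_apply]
    fin_cases i <;> fin_cases j <;> fin_cases k <;> simp [wLike, ket]

/-- The first party measures with two upper triangular Kraus operators whose off-diagonal entries
have opposite signs. The cross terms cancel in the completeness relation, and the outcomes have
amplitudes w and −w, which are LU equivalent. -/
lemma loccReaches_wLike (w : ℂ) {x : Fin 3 → ℂ} (hx : ∀ i, x i ≠ 0) :
    ∃ y : Fin 3 → ℂ, (∀ i, y i ≠ 0) ∧ LOCCReaches (wLike 0 y) (wLike w x) := by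
  have h2 : (0 : ℝ) < 2 := two_pos
  set r : ℂ := ((√2 : ℝ) : ℂ) with hr
  have hr0 : r ≠ 0 := ofReal_sqrt_ne_zero h2
  have hrr : r * r = 2 := by rw [hr, ofReal_sqrt_mul_self h2.le]; simp
  have hrs : star r = r := Complex.conj_ofReal _
  have hpos : 0 < Complex.normSq w + Complex.normSq (x 0) :=
    add_pos_of_nonneg_of_pos (Complex.normSq_nonneg _) (Complex.normSq_pos.2 (hx 0))
  set n : ℂ := ((√(Complex.normSq w + Complex.normSq (x 0)) : ℝ) : ℂ) with hn
  have hn0 : n ≠ 0 := ofReal_sqrt_ne_zero hpos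
  have hnn : n * n = star w * w + star (x 0) * x 0 := by
    rw [hn, ofReal_sqrt_mul_self hpos.le, Complex.ofReal_add, Complex.normSq_eq_conj_mul_self,
      Complex.normSq_eq_conj_mul_self]
    rfl
  have hns : star n = n := Complex.conj_ofReal _
  -- n² = |w|² + |x₀|² normalises the second columns; r = √2 compensates for the probability 1/2 of
  -- each outcome.
  refine ⟨![r * n, r * x 1, r * x 2], fun i => ?_, ?_⟩
  · fin_cases i <;> simp [hr0, hn0, hx]
  have key : ∀ v : ℂ, op (Function.update 1 0 !![1 / r, v / (r * n); 0, x 0 / (r * n)])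
      (wLike 0 ![r * n, r * x 1, r * x 2]) = wLike v x := fun v => by
    rw [op_wLike_of_upper (fun i => by fin_cases i <;> simp)]
    simp
    congr 1
    · field_simp
    · ext i
      fin_cases i <;> simp <;> field_simp
  refine loccReaches_of_measurement 0 (m := 2)
    ![!![1 / r, w / (r * n); 0, x 0 / (r * n)], !![1 / r, -w / (r * n); 0, x 0 / (r * n)]] ?_ ?_
  · have e1 : (starRingEnd ℂ) r = r := hrs
    have e2 : (starRingEnd ℂ) n = n := hns
    simp at hnn
    ext i j
    fin_cases i <;> fin_cases j <;> simp [Fin.sum_univ_two, Matrix.mul_apply, e1, e2] <;>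
      field_simp <;> try ring1
    · linear_combination -hrr
    · linear_combination -2 * hnn - n ^ 2 * hrr
  · intro i
    fin_cases i
    · simp only [Fin.zero_eta, Matrix.cons_val_zero, key]
      simpa using loccReaches_smul 1 (wLike w x)
    · simp only [Fin.mk_one, Matrix.cons_val_one, Matrix.cons_val_fin_one, key]
      exact (wLike_neg_luEquiv w x).loccReaches

lemma wState_eq : wState = wLike 0 1 := by
  simp [wState, wLike]
  abel

lemma wLike_mem {y : Fin 3 → ℂ} (hy : ∀ i, y i ≠ 0) : wLike 0 y ∈ mes3Representatives := by
  refine Or.inr ⟨!![1, 0; 0, y 0 / y 2], !![y 2, 0; 0, y 1], ?_, ?_, ?_, ?_, ?_⟩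
  · intro i j hij
    fin_cases i <;> fin_cases j <;> simp at hij ⊢
  · rw [Matrix.isUnit_iff_isUnit_det, isUnit_iff_ne_zero]
    simp [Matrix.det_fin_two, hy]
  · intro i j hij
    fin_cases i <;> fin_cases j <;> simp at hij ⊢
  · rw [Matrix.isUnit_iff_isUnit_det, isUnit_iff_ne_zero]
    simp [Matrix.det_fin_two, hy]
  · have hy2 := hy 2
    ext ⟨i, j, k⟩
    rw [wState_eq, localOp_apply]
    fin_cases i <;> fin_cases j <;> fin_cases k <;> simp [wLike, ket, hy2, Matrix.one_apply]

/-! ### Normal form in the GHZ class -/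

/-- The symmetric matrix `p + q X` with real coefficients. -/
def gx (p q : ℝ) : Matrix (Fin 2) (Fin 2) ℂ := !![(p : ℂ), (q : ℂ); (q : ℂ), (p : ℂ)]

lemma gx_one_zero : gx 1 0 = 1 := by
  ext i j
  fin_cases i <;> fin_cases j <;> simp [gx]

lemma gx_gram (p q : ℝ) : (gx p q)ᴴ * gx p q =
    !![((p * p + q * q : ℝ) : ℂ), ((2 * (p * q) : ℝ) : ℂ); ((2 * (p * q) : ℝ) : ℂ),
      ((p * p + q * q : ℝ) : ℂ)] := by
  ext i j
  fin_cases i <;> fin_cases j <;> simp [gx, Matrix.mul_apply] <;> ring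

lemma gx_mul_pauliX (p q : ℝ) : gx p q * pauliX = pauliX * gx p q := by
  ext i j
  fin_cases i <;> fin_cases j <;> simp [gx, pauliX]

lemma det_gx_ne_zero {p q : ℝ} (h : |q| < p) : (gx p q).det ≠ 0 := by
  have h1 := abs_lt.1 h
  have h2 : 0 < (p - q) * (p + q) := mul_pos (by linarith) (by linarith)
  have h3 : p * p - q * q ≠ 0 := by nlinarith
  rw [gx, Matrix.det_fin_two_of]
  exact_mod_cast h3

lemma gx_eq_one {p q : ℝ} (h : |q| < p) (h1 : p * p + q * q = 1) (hq : q = 0) : gx p q = 1 := by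
  subst hq
  have hp : 0 < p := by simpa using h
  have : p = 1 := by nlinarith
  rw [this, gx_one_zero]

/-- The state `|000⟩ + z |111⟩`. -/
def gz (z : ℂ) : State 2 2 2 := ket 0 0 0 + z • ket 1 1 1

lemma gz_one : gz 1 = ghz := by simp [gz, ghz]

lemma op_diag_ghz (d e : Fin 3 → ℂ) (hd : ∀ i, d i ≠ 0) :
    op (fun i => !![d i, 0; 0, e i]) ghz =
      (d 0 * d 1 * d 2) • gz (e 0 * e 1 * e 2 / (d 0 * d 1 * d 2)) := by
  have h0 := hd 0
  have h1 := hd 1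
  have h2 := hd 2
  ext ⟨i, j, k⟩
  rw [op_ghz_apply]
  fin_cases i <;> fin_cases j <;> fin_cases k <;> simp [gz, ket]
  field_simp

lemma op_gz_apply (M : LocalTriple) (z : ℂ) (i j k : Fin 2) : op M (gz z) (i, j, k) =
    M 0 i 0 * M 1 j 0 * M 2 k 0 + z * (M 0 i 1 * M 1 j 1 * M 2 k 1) := by
  simp [op_apply, gz, ket, Pi.single_apply]
  ring

/-- Up to a unitary on the left only the Gram matrix matters. Scaling the columns of M to unit
length and moving the phase of their inner product into e makes it 1 + cX with 0 ≤ c < 1, whose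
positive square root is `gx p q`. On GHZ the diagonal factors of the three parties merge into the
single parameter z of `gz`. -/
lemma exists_unitary_mul_gx_mul_diag {M : Matrix (Fin 2) (Fin 2) ℂ} (hM : M.det ≠ 0) :
    ∃ (U : Matrix (Fin 2) (Fin 2) ℂ) (p q : ℝ) (d e : ℂ), Uᴴ * U = 1 ∧ |q| < p ∧
      p * p + q * q = 1 ∧ d ≠ 0 ∧ e ≠ 0 ∧ M = U * (gx p q * !![d, 0; 0, e]) := by
  set α : ℝ := Complex.normSq (M 0 0) + Complex.normSq (M 1 0) with hα
  set γ : ℝ := Complex.normSq (M 0 1) + Complex.normSq (M 1 1) with hγ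
  set β : ℂ := star (M 0 0) * M 0 1 + star (M 1 0) * M 1 1 with hβ
  have hH : Mᴴ * M = !![(α : ℂ), β; star β, (γ : ℂ)] := by
    ext i j
    fin_cases i <;> fin_cases j <;>
      simp [Matrix.mul_apply, hα, hβ, hγ, Complex.normSq_eq_conj_mul_self, mul_comm]
  have hdet : α * γ - ‖β‖ * ‖β‖ = Complex.normSq M.det := by
    have := congrArg Matrix.det hH
    rw [Matrix.det_mul, Matrix.det_conjTranspose, Matrix.det_fin_two_of] at this
    apply Complex.ofReal_injective
    rw [Complex.normSq_eq_conj_mul_self]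
    refine Eq.trans ?_ this.symm
    have hb : β * star β = ((‖β‖ * ‖β‖ : ℝ) : ℂ) := by
      rw [← sq, ← Complex.normSq_eq_norm_sq]
      exact Complex.mul_conj β
    rw [hb]
    push_cast
    rfl
  have hdpos : 0 < α * γ - ‖β‖ * ‖β‖ := hdet ▸ Complex.normSq_pos.2 hM
  have hα0 : 0 ≤ α := add_nonneg (Complex.normSq_nonneg _) (Complex.normSq_nonneg _)
  have hγ0 : 0 ≤ γ := add_nonneg (Complex.normSq_nonneg _) (Complex.normSq_nonneg _)
  have hαγ : 0 < α * γ := by nlinarith [norm_nonneg β]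
  have hαp : 0 < α := hα0.lt_of_ne' (left_ne_zero_of_mul hαγ.ne')
  have hγp : 0 < γ := hγ0.lt_of_ne' (right_ne_zero_of_mul hαγ.ne')
  obtain ⟨ω, hω, hβω⟩ : ∃ ω : ℂ, star ω * ω = 1 ∧ β = ‖β‖ * ω := by
    by_cases hb : β = 0
    · exact ⟨1, by simp, by simp [hb]⟩
    · have hn : (‖β‖ : ℂ) ≠ 0 := by simpa using hb
      refine ⟨β / ‖β‖, ?_, by field_simp⟩
      have hb' : star β * β = ‖β‖ * ‖β‖ := by
        rw [← Complex.ofReal_mul, ← sq, ← Complex.normSq_eq_norm_sq,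
          Complex.normSq_eq_conj_mul_self]
        rfl
      have hs : star (β / ‖β‖) = star β / ‖β‖ := by simp
      rw [hs]
      field_simp
      linear_combination hb'
  have hω0 : ω ≠ 0 := right_ne_zero_of_mul_eq_one hω
  have hsα := ofReal_sqrt_mul_self hα0
  have hsγ := ofReal_sqrt_mul_self hγ0
  have hsα0 := Real.sqrt_pos.2 hαp
  have hsγ0 := Real.sqrt_pos.2 hγp
  set a : ℝ := √α
  set b : ℝ := √γ
  -- Strict Cauchy–Schwarz for the columns of M, which are independent.
  have hab : ‖β‖ < a * b := by
    have h1 : a * a = α := Real.mul_self_sqrt hα0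
    have h2 : b * b = γ := Real.mul_self_sqrt hγ0
    refine lt_of_mul_self_lt_mul_self₀ (mul_pos hsα0 hsγ0).le ?_
    calc ‖β‖ * ‖β‖ < α * γ := by linarith
      _ = a * b * (a * b) := by rw [← h1, ← h2]; ring
  obtain ⟨p, q, hpq, h1, h2⟩ := exists_symm_sqrt (a := 1) (b := ‖β‖ / (a * b)) (by
    rw [abs_of_nonneg (by positivity), div_lt_one (by positivity)]
    exact hab)
  have ha0 : (a : ℂ) ≠ 0 := Complex.ofReal_ne_zero.2 hsα0.ne'
  have hb0 : (b : ℂ) ≠ 0 := Complex.ofReal_ne_zero.2 hsγ0.ne'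
  have hN : Mᴴ * M =
      (gx p q * !![(a : ℂ), 0; 0, b * ω])ᴴ * (gx p q * !![(a : ℂ), 0; 0, b * ω]) := by
    rw [Matrix.conjTranspose_mul, mul_assoc, ← mul_assoc _ (gx p q), gx_gram, h1, h2, hH]
    conv_lhs => rw [hβω]
    simp only [Complex.star_def] at hω
    ext i j
    fin_cases i <;> fin_cases j <;> simp [Matrix.mul_apply] <;> field_simp
    · linear_combination -hsα
    · linear_combination -hsγ - (b : ℂ) ^ 2 * hω
  obtain ⟨U, hU, hMU⟩ := exists_unitary_mul_of_gram_eq (M := M)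
    (N := gx p q * !![(a : ℂ), 0; 0, b * ω]) (by
      rw [Matrix.det_mul, Matrix.det_fin_two_of]
      refine mul_ne_zero (det_gx_ne_zero hpq) ?_
      simp [ha0, hb0, hω0]) hN
  exact ⟨U, p, q, a, b * ω, hU, hpq, h1, ha0, mul_ne_zero hb0 hω0, hMU⟩

/-- The normal form of the states of the GHZ class. -/
lemma exists_luEquiv_gx {M : LocalTriple} (hM : ∀ i, (M i).det ≠ 0) :
    ∃ (p q : Fin 3 → ℝ) (z : ℂ), (∀ i, |q i| < p i) ∧ (∀ i, p i * p i + q i * q i = 1) ∧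
      LUEquiv (op M ghz) (op (fun i => gx (p i) (q i)) (gz z)) := by
  choose U p q d e hU hpq h1 hd he hMU using fun i => exists_unitary_mul_gx_mul_diag (hM i)
  refine ⟨p, q, e 0 * e 1 * e 2 / (d 0 * d 1 * d 2), hpq, h1, luEquiv_iff.2 ⟨U, hU, d 0 * d 1 * d 2,
    mul_ne_zero (mul_ne_zero (hd 0) (hd 1)) (hd 2), ?_⟩⟩
  rw [show M = U * ((fun i => gx (p i) (q i)) * fun i => !![d i, 0; 0, e i]) from funext hMU,
    ← op_op, ← op_op, op_diag_ghz d e hd, op_smul, op_smul]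

/-! ### Protocols in the GHZ class -/

lemma LUEquiv.loccReaches_smul {ψ φ : State 2 2 2} (h : LUEquiv ψ φ) (z : ℂ) :
    LOCCReaches (z • ψ) φ :=
  (MES.loccReaches_smul z ψ).trans h.loccReaches

lemma LUEquiv.refl (ψ : State 2 2 2) : LUEquiv ψ ψ := by
  simpa using luEquiv_smul one_ne_zero ψ

lemma exists_norm_const (z : ℂ) : ∃ n : ℝ, n * n * (1 + Complex.normSq z) = 1 := by
  have h : 0 < 1 + Complex.normSq z := by linarith [Complex.normSq_nonneg z]
  refine ⟨√((1 + Complex.normSq z)⁻¹), ?_⟩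
  rw [Real.mul_self_sqrt (inv_nonneg.2 h.le), inv_mul_cancel₀ h.ne']

lemma pauliX_unitary : pauliXᴴ * pauliX = 1 := by
  ext i j
  fin_cases i <;> fin_cases j <;> simp [pauliX, Matrix.mul_apply]

/-- The Kraus operators are multiples of diag(1, z) and diag(z, 1); the second outcome is turned
into the first by X on all three parties. -/
lemma loccReaches_ghz_gz (z : ℂ) : LOCCReaches ghz (gz z) := by
  obtain ⟨n, hn⟩ := exists_norm_const z
  have hn' : (n : ℂ) * n * (1 + (starRingEnd ℂ) z * z) = 1 := by
    rw [← Complex.normSq_eq_conj_mul_self]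
    exact_mod_cast hn
  refine loccReaches_of_measurement 0 (m := 2)
    ![(n : ℂ) • !![1, 0; 0, z], (n : ℂ) • !![z, 0; 0, 1]] ?_ fun i => ?_
  · ext i j
    fin_cases i <;> fin_cases j <;> simp [Fin.sum_univ_two, Matrix.mul_apply] <;>
      linear_combination hn'
  · fin_cases i
    · simp only [Fin.zero_eta, Matrix.cons_val_zero, op_update_smul]
      convert (LUEquiv.refl (gz z)).loccReaches_smul (n : ℂ) using 2
      ext ⟨i, j, k⟩
      rw [op_ghz_apply]
      fin_cases i <;> fin_cases j <;> fin_cases k <;> simp [gz, ket]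
    · simp only [Fin.mk_one, Matrix.cons_val_one, Matrix.cons_val_fin_one, op_update_smul]
      convert (luEquiv_op (U := fun _ => pauliX) (fun _ => pauliX_unitary)
        (gz z)).loccReaches_smul (n : ℂ) using 2
      ext ⟨i, j, k⟩
      rw [op_ghz_apply, op_gz_apply]
      fin_cases i <;> fin_cases j <;> fin_cases k <;> simp [pauliX]

/-- The Pauli matrix `Z`. -/
def pauliZ : Matrix (Fin 2) (Fin 2) ℂ := !![1, 0; 0, -1]

lemma pauliZ_unitary : pauliZᴴ * pauliZ = 1 := by
  ext i j
  fin_cases i <;> fin_cases j <;> simp [pauliZ, Matrix.mul_apply]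

lemma op_pauliZ_gz (i : Fin 3) (z : ℂ) : op (Function.update 1 i pauliZ) (gz z) = gz (-z) := by
  ext ⟨a, b, c⟩
  rw [op_gz_apply]
  fin_cases i <;> fin_cases a <;> fin_cases b <;> fin_cases c <;> simp [gz, ket, pauliZ]

lemma update_one_unitary {U : Matrix (Fin 2) (Fin 2) ℂ} (hU : Uᴴ * U = 1) (i j : Fin 3) :
    ((Function.update 1 i U : LocalTriple) j)ᴴ * (Function.update 1 i U : LocalTriple) j = 1 := by
  by_cases h : j = i
  · subst h
    simpa using hU
  · simp [h]

lemma update_one_mul_update (g : LocalTriple) (i : Fin 3) (X Y : Matrix (Fin 2) (Fin 2) ℂ) :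
    (Function.update 1 i X : LocalTriple) * Function.update g i Y =
      Function.update g i (X * Y) := by
  ext1 j
  by_cases h : j = i
  · subst h
    simp
  · simp [h]

lemma mul_update_one (g : LocalTriple) (i : Fin 3) (X : Matrix (Fin 2) (Fin 2) ℂ) :
    g * (Function.update 1 i X : LocalTriple) = Function.update g i (g i * X) := by
  ext1 j
  by_cases h : j = i
  · subst h
    simp
  · simp [h]

/-- Party `j` applies `g j` or `g j Z`; in the second case party `i` corrects with a `Z`. -/
lemma loccReaches_update_one {g : LocalTriple} {i j : Fin 3} (hi : g i = 1) {p q : ℝ}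
    (hj : g j = gx p q) (h1 : p * p + q * q = 1) (z : ℂ) :
    LOCCReaches (op (Function.update g j 1) (gz z)) (op g (gz z)) := by
  set s : ℂ := ((√2 : ℝ) : ℂ)⁻¹ with hs
  have hss : s * s = 1 / 2 := by
    rw [hs, ← mul_inv, ofReal_sqrt_mul_self two_pos.le]
    simp
  have hsc : (starRingEnd ℂ) s = s := by rw [hs, map_inv₀, Complex.conj_ofReal]
  have h1' : (p : ℂ) * p + q * q = 1 := by exact_mod_cast h1
  -- Averaging gᴴg over conjugation by Z leaves its diagonal, which is p² + q² = 1.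
  refine loccReaches_of_measurement j (m := 2) ![s • g j, s • (g j * pauliZ)] ?_ fun r => ?_
  · rw [hj]
    ext a b
    fin_cases a <;> fin_cases b <;>
      simp [Fin.sum_univ_two, Matrix.mul_apply, gx, pauliZ, hsc]
    · linear_combination (2 * (p * p + q * q) : ℂ) * hss + h1'
    · ring
    · ring
    · linear_combination (2 * (p * p + q * q) : ℂ) * hss + h1'
  · fin_cases r
    · simp only [Fin.zero_eta, Matrix.cons_val_zero, op_op, update_one_mul_update, mul_one,
        op_update_smul, Function.update_eq_self]
      exact (LUEquiv.refl _).loccReaches_smul s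
    · simp only [Fin.mk_one, Matrix.cons_val_one, Matrix.cons_val_fin_one, op_op,
        update_one_mul_update, mul_one, op_update_smul]
      -- On `gz z` a Z of party j equals a Z of party i, since either replaces z by −z; the latter
      -- commutes with g because g i = 1.
      rw [← mul_update_one, ← op_op, op_pauliZ_gz, ← op_pauliZ_gz i, op_op]
      have : g * (Function.update 1 i pauliZ : LocalTriple) =
          (Function.update 1 i pauliZ : LocalTriple) * g := by
        ext1 k
        by_cases h : k = i
        · subst h
          simp [hi]
        · simp [h]
      rw [this, ← op_op]
      exact (luEquiv_op (update_one_unitary pauliZ_unitary i) _).loccReaches_smul s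

/-- The party with trivial operator makes the Z corrections while the other two apply their
operators one after the other, starting from |000⟩ + z|111⟩. -/
lemma loccReaches_ghz_of_eq_one {p q : Fin 3 → ℝ} (h1 : ∀ i, p i * p i + q i * q i = 1)
    {i : Fin 3} (hi : gx (p i) (q i) = 1) (z : ℂ) :
    LOCCReaches ghz (op (fun i => gx (p i) (q i)) (gz z)) := by
  obtain ⟨j, k, hji, hki, hkj, hall⟩ : ∃ j k : Fin 3, j ≠ i ∧ k ≠ i ∧ k ≠ j ∧
      ∀ l, l = i ∨ l = j ∨ l = k := by
    revert i
    intro i _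
    fin_cases i
    · exact ⟨1, 2, by decide⟩
    · exact ⟨0, 2, by decide⟩
    · exact ⟨0, 1, by decide⟩
  set g : LocalTriple := fun i => gx (p i) (q i) with hg
  have hgi : g i = 1 := hi
  have e1 := loccReaches_update_one (g := g) (i := i) (j := j) hi rfl (h1 j) z
  have e2 := loccReaches_update_one (g := Function.update g j 1) (i := i) (j := k)
    (p := p k) (q := q k) (by simp [hji.symm, hgi]) (by simp [hkj, hg]) (h1 k) z
  have h3 : Function.update (Function.update g j 1) k 1 = 1 := by
    ext1 l
    rcases hall l with rfl | rfl | rfl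
    · simp [hji.symm, hki.symm, hgi]
    · simp [hkj.symm]
    · simp
  rw [h3, op_one] at e2
  exact ((loccReaches_ghz_gz z).trans e2).trans e1

/-- Party `0` implements `g 0 * diag (1, z)`, after which the other two parties correct
with an `X`. -/
lemma loccReaches_gz_of_ghz {p q : Fin 3 → ℝ} (hpq : ∀ i, |q i| < p i)
    (h1 : ∀ i, p i * p i + q i * q i = 1) (z : ℂ) :
    ∃ p' q' : ℝ, |q'| < p' ∧ p' * p' + q' * q' = 1 ∧
      LOCCReaches (op (Function.update (fun i => gx (p i) (q i)) 0 (gx p' q')) ghz)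
        (op (fun i => gx (p i) (q i)) (gz z)) := by
  obtain ⟨n, hn⟩ := exists_norm_const z
  have hnorm : Complex.normSq z = z.re * z.re + z.im * z.im := Complex.normSq_apply z
  have hc : |2 * (p 0 * q 0)| < 1 := by
    have := abs_lt.1 (hpq 0)
    have ha : 0 < (p 0 - q 0) * (p 0 - q 0) := mul_pos (by linarith) (by linarith)
    have hb : 0 < (p 0 + q 0) * (p 0 + q 0) := mul_pos (by linarith) (by linarith)
    have := h1 0
    rw [abs_lt]
    constructor <;> nlinarith
  have hz : |n * n * (2 * z.re)| ≤ 1 := by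
    have h2 : |2 * z.re| ≤ 1 + Complex.normSq z := by
      rw [hnorm, abs_le]
      constructor <;> nlinarith [mul_self_nonneg (z.re - 1), mul_self_nonneg (z.re + 1),
        mul_self_nonneg z.im]
    rw [abs_mul, abs_of_nonneg (mul_self_nonneg n), ← hn]
    exact mul_le_mul_of_nonneg_left h2 (mul_self_nonneg n)
  -- With c = 2p₀q₀ and D = diag(1, z), the sum n²(Dᴴg₀ᴴg₀D + X Dᴴg₀ᴴg₀D X) has diagonal n²(1 +
  -- |z|²) = 1 and off-diagonal n²·2c·Re z. It is positive definite as |c| < 1 and |2 Re z| ≤ 1 +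
  -- |z|²; `gx p' q'` is its square root.
  obtain ⟨p', q', hpq', h1', h2'⟩ := exists_symm_sqrt (a := 1)
    (b := 2 * (p 0 * q 0) * (n * n * (2 * z.re))) (by
      rw [abs_mul]
      exact (mul_le_of_le_one_right (abs_nonneg _) hz).trans_lt hc)
  refine ⟨p', q', hpq', h1', ?_⟩
  set g : LocalTriple := fun i => gx (p i) (q i) with hg
  have hdet := det_gx_ne_zero hpq'
  have hcancel : ∀ L : Matrix (Fin 2) (Fin 2) ℂ, L * (gx p' q')⁻¹ * gx p' q' = L := fun L => by
    rw [mul_assoc, Matrix.nonsing_inv_mul _ hdet.isUnit, mul_one]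
  set D : Matrix (Fin 2) (Fin 2) ℂ := !![1, 0; 0, z] with hD
  -- The inverse of `gx p' q'` undoes the operator of party 0 in the initial state, so the outcomes
  -- carry g₀D and g₀DX there.
  refine loccReaches_of_measurement 0 (m := 2)
    ![(n : ℂ) • (g 0 * D) * (gx p' q')⁻¹, (n : ℂ) • (g 0 * (D * pauliX)) * (gx p' q')⁻¹]
    ?_ fun r => ?_
  · have key : ((n : ℂ) • (g 0 * D))ᴴ * ((n : ℂ) • (g 0 * D)) +
        ((n : ℂ) • (g 0 * (D * pauliX)))ᴴ * ((n : ℂ) • (g 0 * (D * pauliX))) =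
        (gx p' q')ᴴ * gx p' q' := by
      have hexp : ∀ Y : Matrix (Fin 2) (Fin 2) ℂ, ((n : ℂ) • (g 0 * Y))ᴴ * ((n : ℂ) • (g 0 * Y)) =
          ((n * n : ℝ) : ℂ) • (Yᴴ * (((g 0)ᴴ * g 0) * Y)) := fun Y => by
        rw [Matrix.conjTranspose_smul, smul_mul_smul_comm, Matrix.conjTranspose_mul]
        simp [mul_assoc]
      have hn' : (n : ℂ) * n * (1 + (starRingEnd ℂ) z * z) = 1 := by
        rw [← Complex.normSq_eq_conj_mul_self]
        exact_mod_cast hn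
      have hre : z + (starRingEnd ℂ) z = 2 * z.re := by
        rw [Complex.add_conj]
        push_cast
        ring
      rw [hexp, hexp, hg, gx_gram, gx_gram, h1 0, h1', h2']
      ext a b
      fin_cases a <;> fin_cases b <;> simp [hD, pauliX, Matrix.mul_apply]
      · linear_combination hn'
      · linear_combination (n : ℂ) * n * (2 * (p 0 * q 0)) * hre
      · linear_combination (n : ℂ) * n * (2 * (p 0 * q 0)) * hre
      · linear_combination hn'
    have hinv : ((gx p' q')⁻¹)ᴴ * ((gx p' q')ᴴ * gx p' q') * (gx p' q')⁻¹ = 1 := by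
      rw [mul_assoc, mul_assoc, Matrix.mul_nonsing_inv _ hdet.isUnit, mul_one,
        ← Matrix.conjTranspose_mul, Matrix.mul_nonsing_inv _ hdet.isUnit,
        Matrix.conjTranspose_one]
    rw [← hinv, ← key, Fin.sum_univ_two]
    simp only [Matrix.cons_val_zero, Matrix.cons_val_one, Matrix.cons_val_fin_one]
    rw [Matrix.conjTranspose_mul, Matrix.conjTranspose_mul]
    simp only [mul_add, add_mul, mul_assoc]
  · fin_cases r
    · simp only [Fin.zero_eta, Matrix.cons_val_zero, op_op, update_one_mul_update, hcancel,
        op_update_smul]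
      rw [← mul_update_one, ← op_op]
      have : op (Function.update 1 0 D) ghz = gz z := by
        ext ⟨i, j, k⟩
        rw [op_ghz_apply]
        fin_cases i <;> fin_cases j <;> fin_cases k <;> simp [gz, ket, hD]
      rw [this]
      exact (LUEquiv.refl _).loccReaches_smul _
    · simp only [Fin.mk_one, Matrix.cons_val_one, Matrix.cons_val_fin_one, op_op,
        update_one_mul_update, hcancel, op_update_smul]
      rw [← mul_update_one, ← op_op]
      -- X ⊗ X ⊗ X fixes GHZ, so the X of party 0 can be traded for X on the other two, where it
      -- commutes with g.
      have hX : op (Function.update 1 0 (D * pauliX)) ghz =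
          op (Function.update (fun _ => pauliX) 0 1) (gz z) := by
        ext ⟨i, j, k⟩
        rw [op_ghz_apply, op_gz_apply]
        fin_cases i <;> fin_cases j <;> fin_cases k <;> simp [hD, pauliX]
      have hcomm : g * Function.update (fun _ => pauliX) 0 1 =
          Function.update (fun _ => pauliX) 0 1 * g := by
        ext1 k
        by_cases h : k = 0
        · subst h
          simp
        · simp [h, hg, gx_mul_pauliX]
      rw [hX, op_op, hcomm, ← op_op]
      refine (luEquiv_op (fun k => ?_) _).loccReaches_smul _
      by_cases h : k = 0
      · subst h
        simp
      · simpa [h] using pauliX_unitary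

/-! ### Covering, uniqueness and minimality -/

lemma ghz_mem : ghz ∈ mes3Representatives := Or.inl (Or.inl rfl)

lemma exists_loccReaches_gx {p q : Fin 3 → ℝ} (hpq : ∀ i, |q i| < p i)
    (h1 : ∀ i, p i * p i + q i * q i = 1) (z : ℂ) :
    ∃ ψ ∈ mes3Representatives, LOCCReaches ψ (op (fun i => gx (p i) (q i)) (gz z)) := by
  by_cases hq : ∃ i, q i = 0
  · obtain ⟨i, hi⟩ := hq
    exact ⟨ghz, ghz_mem, loccReaches_ghz_of_eq_one h1 (gx_eq_one (hpq i) (h1 i) hi) z⟩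
  push Not at hq
  obtain ⟨p', q', hpq', h1', h⟩ := loccReaches_gz_of_ghz hpq h1 z
  -- The source found for z need not be a representative: for q' = 0 the operator of party 0 is
  -- trivial and the source is itself reached from GHZ.
  by_cases hq' : q' = 0
  · refine ⟨ghz, ghz_mem, LOCCReaches.trans ?_ h⟩
    have := loccReaches_ghz_of_eq_one (p := Function.update p 0 p') (q := Function.update q 0 q')
      (fun i => by fin_cases i <;> simp [h1', h1]) (i := 0)
      (by simpa using gx_eq_one hpq' h1' hq') 1
    rw [gz_one] at this
    convert this using 2
    ext1 i
    fin_cases i <;> simp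
  · refine ⟨_, Or.inl (Or.inr ⟨_, _, _, ?_, ?_, ?_, rfl⟩), h⟩ <;>
      rw [isNontrivialGx_iff]
    · exact ⟨p', q', hq', hpq', by simp [gx]⟩
    · exact ⟨p 1, q 1, hq 1, hpq 1, by simp [gx]⟩
    · exact ⟨p 2, q 2, hq 2, hpq 2, by simp [gx]⟩

lemma FullyEntangled.exists_loccReaches {φ : State 2 2 2} (hφ : FullyEntangled φ) :
    ∃ ψ ∈ mes3Representatives, LOCCReaches ψ φ := by
  obtain ⟨M, rfl | rfl⟩ := hφ.exists_eq_op
  · obtain ⟨p, q, z, hpq, h1, hLU⟩ := exists_luEquiv_gx fun i => hφ.det_ne_zero i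
    obtain ⟨ψ, hψ, h⟩ := exists_loccReaches_gx hpq h1 z
    exact ⟨ψ, hψ, h.trans hLU.symm.loccReaches⟩
  · obtain ⟨w, x, hx, hLU⟩ := exists_luEquiv_wLike fun i => hφ.det_ne_zero i
    obtain ⟨y, hy, h⟩ := loccReaches_wLike w hx
    exact ⟨_, wLike_mem hy, h.trans hLU.symm.loccReaches⟩

lemma representative_fullyEntangled_rigid {φ : State 2 2 2} (h : φ ∈ mes3Representatives) :
    FullyEntangled φ ∧ Rigid φ := by
  rcases h with (h | ⟨g₁, g₂, g₃, h₁, h₂, h₃, rfl⟩) | ⟨g₁, g₂, d₁, u₁, d₂, u₂, rfl⟩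
  · rw [Set.mem_singleton_iff] at h
    subst h
    exact ⟨fullyEntangled_ghz, rigid_ghz⟩
  · have hg : ∀ i, IsNontrivialGx ((![g₁, g₂, g₃] : LocalTriple) i) := fun i => by
      fin_cases i <;> assumption
    change FullyEntangled (op ![g₁, g₂, g₃] ghz) ∧ Rigid (op ![g₁, g₂, g₃] ghz)
    exact ⟨fullyEntangled_ghz.op fun i => (hg i).det_ne_zero, rigid_op_ghz hg⟩
  · have key : ∀ g : Matrix (Fin 2) (Fin 2) ℂ, g.IsDiag → IsUnit g →
        g 0 1 = 0 ∧ g 1 0 = 0 ∧ g 0 0 ≠ 0 ∧ g 1 1 ≠ 0 := fun g hd hu => by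
      have h01 : g 0 1 = 0 := hd (by decide)
      have h10 : g 1 0 = 0 := hd (by decide)
      rw [Matrix.isUnit_iff_isUnit_det, isUnit_iff_ne_zero, Matrix.det_fin_two, h01, zero_mul,
        sub_zero] at hu
      exact ⟨h01, h10, mul_ne_zero_iff.1 hu⟩
    obtain ⟨a1, a2, a3, a4⟩ := key g₁ d₁ u₁
    obtain ⟨b1, b2, b3, b4⟩ := key g₂ d₂ u₂
    have : localOp g₁ g₂ 1 wState =
        wLike 0 ![g₁ 1 1 * g₂ 0 0, g₁ 0 0 * g₂ 1 1, g₁ 0 0 * g₂ 0 0] := by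
      ext ⟨i, j, k⟩
      rw [wState_eq, localOp_apply]
      fin_cases i <;> fin_cases j <;> fin_cases k <;>
        simp [wLike, ket, a1, a2, b1, b2, Matrix.one_apply]
    rw [this]
    have hx : ∀ i, (![g₁ 1 1 * g₂ 0 0, g₁ 0 0 * g₂ 1 1, g₁ 0 0 * g₂ 0 0] : Fin 3 → ℂ) i ≠ 0 :=
      fun i => by fin_cases i <;> simp [a3, a4, b3, b4]
    exact ⟨fullyEntangled_wLike 0 hx, rigid_wLike hx⟩

lemma luEquiv_of_loccReaches_of_mem_mes3 {φ : State 2 2 2} (hφ : φ ∈ mes3) {ψ : State 2 2 2}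
    (hψ : ψ ≠ 0) (h : LOCCReaches ψ φ) : LUEquiv ψ φ := by
  obtain ⟨χ, hχ, hLU⟩ := hφ
  obtain ⟨hE, hR⟩ := representative_fullyEntangled_rigid hχ
  exact (hR.luEquiv_of_loccReaches hE hψ (h.trans hLU.loccReaches)).trans hLU.symm

lemma isMaximallyEntangledSet_mes3 : IsMaximallyEntangledSet mes3 where
  entangled := fun _ ⟨_, hχ, hLU⟩ =>
    hLU.fullyEntangled (representative_fullyEntangled_rigid hχ).1
  lu_closed := fun _ ⟨χ, hχ, hLU⟩ _ h => ⟨χ, hχ, h.trans hLU⟩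
  covers := fun _ hφ _ =>
    let ⟨ψ, hψ, h⟩ := hφ.exists_loccReaches
    ⟨ψ, ⟨ψ, hψ, .refl ψ⟩, h⟩
  unreachable := fun _ hφ _ hψ h => luEquiv_of_loccReaches_of_mem_mes3 hφ hψ h

/-- A state of `mes3` outside S would be reached from some state of S, which is then LU equivalent
to it; LU-closedness of S contradicts this. -/
lemma IsCovering.mes3_subset {S : Set (State 2 2 2)} (hS : IsCovering S) : mes3 ⊆ S := by
  intro φ hφ
  by_contra hn
  obtain ⟨ψ, hψ, h⟩ := hS.covers φ (isMaximallyEntangledSet_mes3.entangled φ hφ) hn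
  have hLU := luEquiv_of_loccReaches_of_mem_mes3 hφ (hS.entangled ψ hψ).ne_zero h
  exact hn (hS.lu_closed ψ hψ φ hLU.symm)

/-- Each state of S is reached from some representative, and unreachability in S makes the two LU
equivalent. -/
lemma IsMaximallyEntangledSet.eq_mes3 {S : Set (State 2 2 2)} (hS : IsMaximallyEntangledSet S) :
    S = mes3 := by
  refine Set.Subset.antisymm (fun φ hφ => ?_) hS.toIsCovering.mes3_subset
  obtain ⟨ψ, hψ, h⟩ := (hS.entangled φ hφ).exists_loccReaches
  have hE := (representative_fullyEntangled_rigid hψ).1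
  exact ⟨ψ, hψ, (hS.unreachable φ hφ ψ hE.ne_zero h).symm⟩

end MES

theorem theorem1 :
    (∀ S : Set (MES.State 2 2 2), MES.IsMaximallyEntangledSet S ↔ S = MES.mes3) ∧
    IsLeast {S : Set (MES.State 2 2 2) | MES.IsCovering S} MES.mes3 :=
  ⟨fun _ => ⟨fun hS => hS.eq_mes3, fun h => h ▸ MES.isMaximallyEntangledSet_mes3⟩,
    MES.isMaximallyEntangledSet_mes3.toIsCovering, fun _ hS => hS.mes3_subset⟩
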